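/- **Setting.** Let $\mathcal X$ (states) and $\mathcal U$ (controls) be Borel spaces, i.e. homeomorphic to Borel subsets of Polish spaces. Let $U:\mathcal X\rightrightarrows\mathcal U$ be a measurable multifunction with nonempty values, let $Q$ be a measurable map from $\mathrm{graph}(U)$ to the probability measures on $\mathcal X$, and let $c:\mathcal X\times\mathcal U\times\mathcal X\to\mathbb R$ be a cost function. Let $x_{\rm A}\in\mathcal X$ be an absorbing state: $Q(\{x_{\rm A}\}\mid x_{\rm A},u)=1$ and $c(x_{\rm A},u,x_{\rm A})=0$ for all $u\in U(x_{\rm A})$. Let $P_0$ be a probability measure on $\mathcal X$, $p\in[1,\infty)$, $1/p+1/q=1$, and $\mathcal V=L_p(\mathcal X,P_0)$. Let $\mathcal M$ be the set of probability measures $m\ll P_0$ with $dm/dP_0\in L_q(P_0)$, with the weak* topology given by the pairing $\langle\varphi,m\rangle=\int\varphi\,dm$, $\varphi\in\mathcal V$. Let $\sigma:\mathcal V\times\mathcal X\times\mathcal M\to\mathbb R$ be a law invariant risk transition mapping. This means that $\sigma$ is measurable; that for all $x,m$ the functional $\sigma(\cdot,x,m)$ is a coherent measure of risk (convex, monotone,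 $\sigma(a+\varphi,x,m)=a+\sigma(\varphi,x,m)$ for $a\in\mathbb R$, $\sigma(\beta\varphi,x,m)=\beta\sigma(\varphi,x,m)$ for $\beta\ge0$); and that $\sigma(\varphi,x,\mu)=\sigma(\psi,x,\nu)$ whenever the distribution of $\varphi$ under $\mu$ equals that of $\psi$ under $\nu$. Let $\mathcal A(x,m)=\{\mu\in\mathcal M:\langle\varphi,\mu\rangle\le\sigma(\varphi,x,m)\ \forall\varphi\in\mathcal V\}$ be the subdifferential of $\sigma(\cdot,x,m)$ at $0$. Let $w:\mathcal X\to[1,\infty)$, $w\in\mathcal V$, be a measurable weight function. A function $v:\mathcal X\to\mathbb R$ is $w$-bounded if $|v|\le Cw$ for some constant $C$. **Assumptions.** - (G0) $Q(x,u)\in\mathcal M$ for all $(x,u)\in\mathrm{graph}(U)$. - (G1) $Q$ is weakly* continuous: $(x,u)\mapsto\int v(y)\,Q(dy\mid x,u)$ is continuous on $\mathrm{graph}(U)$ for every $v\in\mathcal V$. - (G2) The multifunction $(x,m)\mapsto\mathcal A(x,m)$ is lower semicontinuous on $\mathcal X\times\mathcal M$: if $(x_k,m_k)\to(x,m)$,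 then every weak* open set that meets $\mathcal A(x,m)$ meets $\mathcal A(x_k,m_k)$ for all large $k$. - (G3) $c$ is measurable; $|c(x,u,y)|\le C(w(x)+w(y))$ for all $x,y\in\mathcal X$, $u\in U(x)$ and some constant $C$; and $c(\cdot,\cdot,y)$ is lower semicontinuous for every $y$. - (G4) $U(x)$ is compact for every $x$. A *decision rule* is a measurable $\pi:\mathcal X\to\mathcal U$ with $\pi(x)\in U(x)$ for all $x$; it defines the stationary deterministic Markov policy $\varPi=\{\pi,\pi,\dots\}$. Put $J_0(\varPi,\cdot)=0$ and $J_{T+1}(\varPi,x)=\sigma\big(c(x,\pi(x),\cdot)+J_T(\varPi,\cdot),x,Q(x,\pi(x))\big)$ (the nested one-step risks of the first $T+1$ costs), $J_\infty(\varPi,x)=\lim_{T\to\infty}J_T(\varPi,x)$, and $J^*(x)=\inf_{\varPi}J_\infty(\varPi,x)$, the infimum being over all stationary deterministic Markov policies. Let $\widetilde{\mathcal X}=\mathcal X\setminus\{x_{\rm A}\}$. For $x\in\widetilde{\mathcal X}$ let $\widetilde{\mathfrak M}^\pi(x)$ be the set of restrictions to $\widetilde{\mathcal X}$ of the measures in $\mathcal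 A(x,Q(x,\pi(x)))$. Multikernels (set-valued maps from $\widetilde{\mathcal X}$ to measures on $\widetilde{\mathcal X}$) are composed through measurable selectors, $[\mathfrak M_1\mathfrak M_2](x)=\{[M_1M_2](x): M_i \text{ a measurable selector of } \mathfrak M_i\}$, where $[M_1M_2](B\mid x)=\int M_2(B\mid y)\,M_1(dy\mid x)$, and they are added by Minkowski sums of their values. Assume that the model is *uniformly risk-transient* with weight $w$: there is a constant $K$ such that for all decision rules $\pi$, all $T\ge0$, and all measurable selectors $M$ of $\sum_{j=1}^T(\widetilde{\mathfrak M}^\pi)^j$, $$\int_{\widetilde{\mathcal X}}w(y)\,M(dy\mid x)\le K\,w(x)\quad\text{for all } x\in\widetilde{\mathcal X}.$$ **Theorem.** Under these assumptions the limits $J_\infty(\varPi,x)$ exist and are finite for every stationary deterministic Markov policy $\varPi$ and every $x\in\mathcal X$, and $J^*$ is finite, measurable and $w$-bounded. A measurable $w$-bounded function $v:\mathcal X\to\mathbb R$ satisfies $$v(x)=\inf_{u\in U(x)}\sigma\big(c(x,u,\cdot)+v(\cdot),x,Q(x,u)\big),\quad x\in\mathcal X,\qquad v(x_{\rm A})=0,$$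 if and only if $v(x)=J^*(x)$ for all $x\in\mathcal X$. Moreover, for $v=J^*$ there is a decision rule $\pi^*$ such that $\pi^*(x)$ attains the infimum on the right hand side for every $x\in\mathcal X$, and every such $\pi^*$ defines an optimal policy $\varPi^*=\{\pi^*,\pi^*,\dots\}$: $J_\infty(\varPi^*,x)=J^*(x)$ for all $x\in\mathcal X$. -/

import Mathlib

open MeasureTheory ProbabilityTheory Filter Topology
open scoped ENNReal

noncomputable section

namespace RiskAverse

/-! ### Reference space and probability measures in its dual -/

section Spaces

variable {X : Type*} [MeasurableSpace X]

/-- `m` is a probability measure which is absolutely continuous with respect to `P₀` and whose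
density lies in `L_q(P₀)`, where `1/p + 1/q = 1`. -/
def InDual (p : ℝ≥0∞) (P₀ : Measure X) (m : Measure X) : Prop :=
  IsProbabilityMeasure m ∧ m ≪ P₀ ∧
    MemLp (fun y => (m.rnDeriv P₀ y).toReal) (ENNReal.conjExponent p) P₀

/-- The set `ℳ` of probability measures in the dual of `𝒱 = L_p(P₀)`. -/
def ProbDual (p : ℝ≥0∞) (P₀ : Measure X) : Type _ := {m : Measure X // InDual p P₀ m}

/-- The pairing `⟨φ, m⟩ = ∫ φ dm`. -/
def pairing {p : ℝ≥0∞} {P₀ : Measure X} (φ : Lp ℝ p P₀) (m : ProbDual p P₀) : ℝ :=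
  ∫ y, φ y ∂m.1

/-- The weak* topology on `ℳ`. -/
instance (p : ℝ≥0∞) (P₀ : Measure X) : TopologicalSpace (ProbDual p P₀) :=
  TopologicalSpace.induced (fun m (φ : Lp ℝ p P₀) => pairing φ m) inferInstance

/-- The σ-algebra on `ℳ` generated by the evaluations `m ↦ m(B)`, `B` measurable. -/
instance (p : ℝ≥0∞) (P₀ : Measure X) : MeasurableSpace (ProbDual p P₀) :=
  MeasurableSpace.comap Subtype.val inferInstance

/-- The Borel σ-algebra of the Banach space `𝒱 = L_p(P₀)`. -/
instance (p : ℝ≥0∞) [Fact (1 ≤ p)] (P₀ : Measure X) : MeasurableSpace (Lp ℝ p P₀) :=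
  borel (Lp ℝ p P₀)

open Classical in
/-- The element of `𝒱` represented by a function on `X` (and `0` for functions which are not
`p`-integrable; no such function occurs under the assumptions below). -/
def toV (p : ℝ≥0∞) (P₀ : Measure X) (f : X → ℝ) : Lp ℝ p P₀ :=
  if h : MemLp f p P₀ then h.toLp f else 0

/-- A law invariant risk transition mapping: jointly measurable, a coherent measure of risk
in its first argument (A1-A4), and law invariant. -/
structure IsRiskTransition {p : ℝ≥0∞} [Fact (1 ≤ p)] {P₀ : Measure X} [IsProbabilityMeasure P₀]
    (σ : Lp ℝ p P₀ → X → ProbDual p P₀ → ℝ) : Prop where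
  measurable : Measurable fun z : Lp ℝ p P₀ × X × ProbDual p P₀ => σ z.1 z.2.1 z.2.2
  convex : ∀ x m (φ ψ : Lp ℝ p P₀) (a : ℝ), 0 < a → a < 1 →
    σ (a • φ + (1 - a) • ψ) x m ≤ a * σ φ x m + (1 - a) * σ ψ x m
  mono : ∀ x m (φ ψ : Lp ℝ p P₀), φ ≤ ψ → σ φ x m ≤ σ ψ x m
  translation : ∀ x m (φ : Lp ℝ p P₀) (a : ℝ), σ (Lp.const p P₀ a + φ) x m = a + σ φ x m
  pos_homogeneous : ∀ x m (φ : Lp ℝ p P₀) (b : ℝ), 0 ≤ b → σ (b • φ) x m = b * σ φ x m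
  law_invariant : ∀ x (μ ν : ProbDual p P₀) (φ ψ : Lp ℝ p P₀),
    (∀ η : ℝ, μ.1 {y | φ y ≤ η} = ν.1 {y | ψ y ≤ η}) → σ φ x μ = σ ψ x ν

/-- The set `𝒜(x, m)`: the subdifferential of `σ(·, x, m)` at `0`. For a coherent measure of risk
`σ(0, x, m) = 0` and every subgradient is a probability measure, so that only elements of `ℳ`
need to be considered. -/
def riskSet {p : ℝ≥0∞} {P₀ : Measure X} (σ : Lp ℝ p P₀ → X → ProbDual p P₀ → ℝ)
    (x : X) (m : ProbDual p P₀) : Set (ProbDual p P₀) :=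
  {μ | ∀ φ : Lp ℝ p P₀, σ 0 x m + pairing φ μ ≤ σ φ x m}

/-- Lower semicontinuity of the multifunction `(x, m) ↦ 𝒜(x, m)`, for the topology of `X` and the
weak* topology of `ℳ`: if `(xₖ, mₖ) → (x, m)`, then every neighbourhood of every point of
`𝒜(x, m)` meets `𝒜(xₖ, mₖ)` for all large `k`. This is implied by openness of the sets
`{(x, m) | 𝒜(x, m) ∩ O ≠ ∅}`, `O` open, and also by the existence of `μₖ ∈ 𝒜(xₖ, mₖ)` with
`μₖ → μ`, for all `(xₖ, mₖ) → (x, m)` and `μ ∈ 𝒜(x, m)`. -/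
def RiskSetLSC [TopologicalSpace X] {p : ℝ≥0∞} {P₀ : Measure X}
    (σ : Lp ℝ p P₀ → X → ProbDual p P₀ → ℝ) : Prop :=
  ∀ (xs : ℕ → X) (ms : ℕ → ProbDual p P₀) (x : X) (m : ProbDual p P₀),
    Tendsto xs atTop (𝓝 x) → Tendsto ms atTop (𝓝 m) →
    ∀ μ ∈ riskSet σ x m, ∀ O : Set (ProbDual p P₀), IsOpen O → μ ∈ O →
      ∀ᶠ k in atTop, (riskSet σ (xs k) (ms k) ∩ O).Nonempty

end Spaces

/-! ### Multikernels -/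

section Multikernels

variable {Y : Type*} [MeasurableSpace Y]

/-- `N` is a measurable selector of the set-valued map `𝔐`. -/
def IsSelector (N : Kernel Y Y) (𝔐 : Y → Set (Measure Y)) : Prop := ∀ y, N y ∈ 𝔐 y

/-- Composition of multikernels; `(N₂ ∘ₖ N₁) y B = ∫ N₂(B | z) N₁(dz | y)`. -/
def mcomp (𝔐₁ 𝔐₂ : Y → Set (Measure Y)) : Y → Set (Measure Y) := fun y =>
  {μ | ∃ N₁ N₂ : Kernel Y Y, IsSelector N₁ 𝔐₁ ∧ IsSelector N₂ 𝔐₂ ∧ μ = (N₂ ∘ₖ N₁) y}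

/-- Powers of a multikernel. -/
def mpow (𝔐 : Y → Set (Measure Y)) : ℕ → Y → Set (Measure Y)
  | 0 => fun y => {Measure.dirac y}
  | 1 => 𝔐
  | k + 2 => mcomp (mpow 𝔐 (k + 1)) 𝔐

/-- The Minkowski sum `∑_{j=1}^T 𝔐^j`. -/
def msum (𝔐 : Y → Set (Measure Y)) : ℕ → Y → Set (Measure Y)
  | 0 => fun _ => {0}
  | T + 1 => fun y => {μ | ∃ μ₁ ∈ msum 𝔐 T y, ∃ μ₂ ∈ mpow 𝔐 (T + 1) y, μ = μ₁ + μ₂}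

end Multikernels

/-! ### Controlled Markov models -/

/-- A stationary controlled Markov model with an absorbing state. -/
structure Model (X 𝒰 : Type*) [MeasurableSpace X] [TopologicalSpace 𝒰] [MeasurableSpace 𝒰] where
  /-- the control sets -/
  U : X → Set 𝒰
  U_nonempty : ∀ x, (U x).Nonempty
  U_measurable : ∀ O : Set 𝒰, IsOpen O → MeasurableSet {x | (U x ∩ O).Nonempty}
  /-- the controlled transition kernel, defined on the graph of `U` -/
  Q : Kernel {z : X × 𝒰 // z.2 ∈ U z.1} X
  Q_markov : IsMarkovKernel Q
  /-- the cost `c x u y` of the transition from `x` to `y` under the control `u` -/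
  c : X → 𝒰 → X → ℝ
  /-- the absorbing state -/
  xA : X
  Q_absorbing : ∀ u (hu : u ∈ U xA), Q ⟨(xA, u), hu⟩ {xA} = 1
  c_absorbing : ∀ u ∈ U xA, c xA u xA = 0

/-- A real function is `w`-bounded. -/
def WBounded {X : Type*} (w v : X → ℝ) : Prop := ∃ C : ℝ, ∀ x, |v x| ≤ C * w x

namespace Model

variable {X 𝒰 : Type*} [MeasurableSpace X] [TopologicalSpace 𝒰] [MeasurableSpace 𝒰]
  (G : Model X 𝒰) {p : ℝ≥0∞} {P₀ : Measure X}

/-- The graph of the control multifunction. -/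
abbrev Graph : Type _ := {z : X × 𝒰 // z.2 ∈ G.U z.1}

/-- (G0) Every `Q(x, u)` belongs to the dual space of `L_p(P₀)`. -/
def G0 (p : ℝ≥0∞) (P₀ : Measure X) : Prop := ∀ z : G.Graph, InDual p P₀ (G.Q z)

variable {G}

/-- The kernel `Q` as a map into `ℳ`. -/
def q (h0 : G.G0 p P₀) (z : G.Graph) : ProbDual p P₀ := ⟨G.Q z, h0 z⟩

/-- (G1) `Q` is weakly* continuous on the graph of `U`. -/
def G1 [TopologicalSpace X] (h0 : G.G0 p P₀) : Prop :=
  ∀ φ : Lp ℝ p P₀, Continuous fun z : G.Graph => pairing φ (q h0 z)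

variable (G)

/-- (G3) The cost is measurable, `w`-bounded, and lower semicontinuous in its first two
arguments. -/
def G3 [TopologicalSpace X] (w : X → ℝ) : Prop :=
  Measurable (fun z : X × 𝒰 × X => G.c z.1 z.2.1 z.2.2) ∧
  (∃ C : ℝ, ∀ x, ∀ u ∈ G.U x, ∀ y, |G.c x u y| ≤ C * (w x + w y)) ∧
  ∀ y, LowerSemicontinuous fun z : X × 𝒰 => G.c z.1 z.2 y

/-- (G4) The multifunction `U`, which is measurable by definition, is compact-valued. -/
def G4 : Prop := ∀ x, IsCompact (G.U x)

/-- Deterministic decision rules, that is, measurable selectors of `U`. They represent the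
stationary deterministic Markov policies. -/
def Rule : Type _ := {π : X → 𝒰 // Measurable π ∧ ∀ x, π x ∈ G.U x}

variable {G}

/-- The point `(x, π(x))` of the graph of `U`. -/
def Rule.at (π : G.Rule) (x : X) : G.Graph := ⟨(x, π.1 x), π.2.2 x⟩

/-- `σ(c(x, u, ·) + v(·), x, Q(x, u))` for `(x, u)` in the graph of `U`. -/
def stageRisk (h0 : G.G0 p P₀) (σ : Lp ℝ p P₀ → X → ProbDual p P₀ → ℝ) (v : X → ℝ)
    (z : G.Graph) : ℝ :=
  σ (toV p P₀ fun y => G.c z.1.1 z.1.2 y + v y) z.1.1 (q h0 z)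

/-- The risk `J_T(Π, x)` of the first `T` costs under `Π = {π, π, …}`: the nested composition
`ρ₁(c(x₁, π(x₁), x₂) + ρ₂(c(x₂, π(x₂), x₃) + ⋯ + ρ_T(c(x_T, π(x_T), x_{T+1})) ⋯ ))` of the one-step
conditional risk measures `ρ_t(g(x_t, u_t, x_{t+1})) = σ(g(x_t, u_t, ·), x_t, Q(x_t, u_t))`. -/
def finiteRisk (h0 : G.G0 p P₀) (σ : Lp ℝ p P₀ → X → ProbDual p P₀ → ℝ) (π : G.Rule) :
    ℕ → X → ℝ
  | 0 => fun _ => 0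
  | T + 1 => fun x => stageRisk h0 σ (finiteRisk h0 σ π T) (π.at x)

/-- `J_∞(Π, x) = lim_T J_T(Π, x)`. -/
def totalRisk (h0 : G.G0 p P₀) (σ : Lp ℝ p P₀ → X → ProbDual p P₀ → ℝ) (π : G.Rule) (x : X) : ℝ :=
  limUnder atTop fun T => finiteRisk h0 σ π T x

/-- `J^*(x)`, the infimum of `J_∞(Π, x)` over all stationary deterministic Markov policies. -/
def optimalValue (h0 : G.G0 p P₀) (σ : Lp ℝ p P₀ → X → ProbDual p P₀ → ℝ) (x : X) : ℝ :=
  ⨅ π : G.Rule, totalRisk h0 σ π x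

/-- The risk multikernel `𝔐^π(x) = 𝒜(x, Q(x, π(x)))`. -/
def riskMultikernel (h0 : G.G0 p P₀) (σ : Lp ℝ p P₀ → X → ProbDual p P₀ → ℝ) (π : G.Rule)
    (x : X) : Set (Measure X) :=
  Subtype.val '' riskSet σ x (q h0 (π.at x))

/-- The effective multikernel on the effective state space `X \ {x_A}`: the measures in `𝔐^π(x)`
are restricted to measurable subsets of `X \ {x_A}`. -/
def effMultikernel (h0 : G.G0 p P₀) (σ : Lp ℝ p P₀ → X → ProbDual p P₀ → ℝ) (π : G.Rule)
    (x : {x : X // x ≠ G.xA}) : Set (Measure {x : X // x ≠ G.xA}) :=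
  (fun μ : Measure X => μ.comap Subtype.val) '' riskMultikernel h0 σ π x.1

/-- The model is uniformly risk-transient with the weight function `w`: there is `K` such that
`‖M‖_w ≤ K` for all decision rules `π`, all `T ≥ 0`, and all measurable selectors `M` of
`∑_{j=1}^T (effective multikernel of π)^j`. -/
def UniformlyRiskTransient (h0 : G.G0 p P₀) (σ : Lp ℝ p P₀ → X → ProbDual p P₀ → ℝ)
    (w : X → ℝ) : Prop :=
  ∃ K : ℝ, ∀ (π : G.Rule) (T : ℕ) (M : Kernel {x : X // x ≠ G.xA} {x : X // x ≠ G.xA}),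
    IsSelector M (msum (effMultikernel h0 σ π) T) →
      ∀ x, ∫⁻ y, ENNReal.ofReal (w y.1) ∂(M x) ≤ ENNReal.ofReal (K * w x.1)

/-- The risk-averse dynamic programming equations
`v(x) = inf_{u ∈ U(x)} σ(c(x, u, ·) + v(·), x, Q(x, u))`, `x ∈ X`, and `v(x_A) = 0`. -/
def DPEquations (h0 : G.G0 p P₀) (σ : Lp ℝ p P₀ → X → ProbDual p P₀ → ℝ) (v : X → ℝ) : Prop :=
  (∀ x, IsGLB (Set.range fun u : G.U x => stageRisk h0 σ v ⟨(x, u.1), u.2⟩) (v x)) ∧ v G.xA = 0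

/-- `π(x)` minimizes `σ(c(x, u, ·) + v(·), x, Q(x, u))` over `u ∈ U(x)`, for every `x`. -/
def IsMinimizer (h0 : G.G0 p P₀) (σ : Lp ℝ p P₀ → X → ProbDual p P₀ → ℝ) (v : X → ℝ)
    (π : G.Rule) : Prop :=
  ∀ z : G.Graph, stageRisk h0 σ v (π.at z.1.1) ≤ stageRisk h0 σ v z

end Model

end RiskAverse

end

/-! A coherent risk σ(·, x, m) is sublinear, monotone and automatically bounded on L_p, so it is the
maximum of ⟨·, μ⟩ over μ ∈ 𝒜(x, m), and the maximizer can be chosen measurably in x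
(`exists_measurable_selector`). Let D_π v(x) = σ(c(x, π(x), ·) + v, x, Q(x, π(x))). Sublinearity and
monotonicity give |D_π v - D_π v'| ≤ σ(|v - v'|), hence D_π^T v and D_π^T v' differ by at most a
constant times the T-fold risk of the weight (`iterWeight`), the weight being set to 0 at the
absorbing state.

By choosing maximizing selectors step by step, the T-fold risk of the weight becomes an integral of
w against a composition of T selectors of the effective multikernel. Sums of such compositions are
selectors of the Minkowski sums, so uniform transience bounds the series of iterated risks by (K +
1)w (`exists_sum_iterWeight_le`). This summability replaces a contraction property: J_T is Cauchy,
J_∞ is a fixed point of D_π, and D_π^T v → J_∞ for every w-bounded v vanishing at the absorbing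
state. With monotonicity, v ≤ D_π v implies v ≤ J_∞, and v ≥ D_π v implies v ≥ J_∞ (`le_totalRisk`,
`totalRisk_le`). A solution of the dynamic programming equations that admits a measurable minimizer
is therefore the infimum J^*, attained by every minimizer. A solution exists as the decreasing limit
of policy iteration (`exists_solution`).

Minimizers (`exists_isMinimizer`) come from lower semicontinuity of the one-step risk in (x, u),
which the dual representation derives from lower semicontinuity of 𝒜, followed by measurable
selection of minimizers on compact sets. Since w need not be continuous, the costs are first
truncated below to provide a common integrable minorant. -/

noncomputable section

namespace RiskAverse

/-! ### Duality between L_p and measures with L_q densities -/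

section LpTools

variable {X : Type*} [MeasurableSpace X] {p : ℝ≥0∞} [Fact (1 ≤ p)] {P₀ : Measure X}
  [IsProbabilityMeasure P₀]

lemma InDual.integrable {m : Measure X} (hm : InDual p P₀ m) {f : X → ℝ} (hf : MemLp f p P₀) :
    Integrable f m := by
  obtain ⟨_, hac, hd⟩ := hm
  rw [← integrable_rnDeriv_smul_iff hac]
  exact memLp_one_iff_integrable.1 (hf.mul (p := ENNReal.conjExponent p) (q := p) hd)

/-- Converse Hölder inequality. -/
lemma inDual_of_lintegral_le (hp : p ≠ ∞) {m : Measure X} [IsProbabilityMeasure m] (C : NNReal)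
    (h : ∀ f : X → ℝ≥0∞, Measurable f → ∫⁻ x, f x ∂m ≤ C * eLpNorm f p P₀) : InDual p P₀ m := by
  have hp1 : 1 ≤ p := Fact.out
  have hp0 : p ≠ 0 := (zero_lt_one.trans_le hp1).ne'
  have hac : m ≪ P₀ := by
    refine Measure.AbsolutelyContinuous.mk fun s hs h0 => ?_
    have := h (s.indicator fun _ => 1) (measurable_const.indicator hs)
    rw [lintegral_indicator_const hs, one_mul] at this
    have h2 : eLpNorm (s.indicator fun _ => (1 : ℝ≥0∞)) p P₀ = 0 := by
      rw [eLpNorm_eq_zero_iff (measurable_const.indicator hs).aestronglyMeasurable hp0]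
      exact indicator_meas_zero h0
    simpa [h2] using this
  have hmeas := Measure.measurable_rnDeriv m P₀
  refine ⟨inferInstance, hac, ?_⟩
  rcases hp1.eq_or_lt with rfl | hlt
  · have hle : ∀ᵐ x ∂P₀, m.rnDeriv P₀ x ≤ C := by
      refine ae_le_of_forall_setLIntegral_le_of_sigmaFinite hmeas fun s hs _ => ?_
      rw [Measure.setLIntegral_rnDeriv hac, setLIntegral_const]
      have := h (s.indicator fun _ => 1) (measurable_const.indicator hs)
      rw [lintegral_indicator_const hs, one_mul, eLpNorm_one_eq_lintegral_enorm] at this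
      refine this.trans (le_of_eq ?_)
      congr 1
      simp only [enorm_eq_self]
      rw [lintegral_indicator_const hs, one_mul]
    have hq : ENNReal.conjExponent 1 = ∞ := by simp [ENNReal.conjExponent]
    rw [hq]
    refine memLp_top_of_bound hmeas.ennreal_toReal.aestronglyMeasurable C ?_
    filter_upwards [hle] with x hx
    rw [Real.norm_of_nonneg ENNReal.toReal_nonneg]
    exact ENNReal.toReal_le_coe_of_le_coe hx
  · set q := ENNReal.conjExponent p with hq
    have hpq : p.HolderConjugate q := inferInstance
    have hq1 : 1 ≤ q := hpq.symm.one_le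
    have hqtop : q ≠ ∞ := by
      rw [hq, ENNReal.conjExponent]
      simp [tsub_eq_zero_iff_le, hlt]
    have hr : p.toReal.HolderConjugate q.toReal :=
      ENNReal.HolderConjugate.toReal_of_ne_top hp hqtop
    set r := p.toReal with hrdef
    set s := q.toReal with hsdef
    have hspos : 0 < s := hr.symm.pos
    have hrpos : 0 < r := hr.pos
    -- The extremal test function for a density g is g^(s-1). Truncating at n keeps I = ∫ g^s
    -- finite, so that I ≤ C I^(1/r), which uses (s-1)r = s, may be divided by I^(1/r). The bound I
    -- ≤ C^s does not depend on n and passes to the limit by monotone convergence.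
    set g : ℕ → X → ℝ≥0∞ := fun n x => min (m.rnDeriv P₀ x) n with hg
    have hgm : ∀ n, Measurable (g n) := fun n => hmeas.min measurable_const
    have key : ∀ n, ∫⁻ x, g n x ^ s ∂P₀ ≤ (C : ℝ≥0∞) ^ s := by
      intro n
      set I := ∫⁻ x, g n x ^ s ∂P₀ with hI
      have hItop : I ≠ ∞ := by
        have : I ≤ ∫⁻ _, (n : ℝ≥0∞) ^ s ∂P₀ :=
          lintegral_mono fun x => ENNReal.rpow_le_rpow (min_le_right _ _) hspos.le
        refine ne_top_of_le_ne_top ?_ this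
        simp [hspos.le]
      have h1 : I ≤ ∫⁻ x, g n x ^ (s - 1) ∂m := by
        rw [← lintegral_rnDeriv_mul hac ((hgm n).pow_const _).aemeasurable]
        refine lintegral_mono fun x => ?_
        have : g n x ^ s = g n x * g n x ^ (s - 1) := by
          conv_lhs => rw [← add_sub_cancel 1 s]
          rw [ENNReal.rpow_add_of_nonneg _ _ zero_le_one (sub_nonneg.2 hr.symm.lt.le),
            ENNReal.rpow_one]
        simp only [this]
        gcongr
        exact min_le_left _ _
      have h2 : I ≤ C * I ^ (1 / r) := by
        refine (h1.trans (h _ ((hgm n).pow_const _))).trans (le_of_eq ?_)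
        rw [eLpNorm_eq_lintegral_rpow_enorm_toReal hp0 hp]
        simp only [enorm_eq_self, ← ENNReal.rpow_mul, ← hrdef]
        rw [hr.symm.sub_one_mul_conj]
      by_cases hI0 : I = 0
      · rw [hI0]; exact bot_le
      have h3 : I = I ^ (1 / s) * I ^ (1 / r) := by
        rw [← ENNReal.rpow_add _ _ hI0 hItop]
        have := hr.symm.inv_add_inv_eq_one
        rw [one_div, one_div, this, ENNReal.rpow_one]
      have h4 : I ^ (1 / s) ≤ C := by
        rw [h3] at h2
        have h5 : I ^ (1 / r) ≠ 0 := by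
          simp [ENNReal.rpow_eq_zero_iff, hI0, hItop]
        have h6 : I ^ (1 / r) ≠ ∞ := ENNReal.rpow_ne_top_of_nonneg (by positivity) hItop
        rw [← h3] at h2
        nth_rewrite 1 [h3] at h2
        exact (ENNReal.mul_le_mul_iff_left h5 h6).1 h2
      calc I = (I ^ (1 / s)) ^ s := by
            rw [← ENNReal.rpow_mul, one_div_mul_cancel hspos.ne', ENNReal.rpow_one]
        _ ≤ _ := ENNReal.rpow_le_rpow h4 hspos.le
    have hlim : ∫⁻ x, m.rnDeriv P₀ x ^ s ∂P₀ ≤ (C : ℝ≥0∞) ^ s := by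
      have hsup : ∀ x, m.rnDeriv P₀ x ^ s = ⨆ n, g n x ^ s := by
        intro x
        refine (tendsto_nhds_unique (tendsto_atTop_iSup ?_) ?_).symm
        · intro i j hij
          exact ENNReal.rpow_le_rpow (min_le_min_left _ (by exact_mod_cast hij)) hspos.le
        · refine (ENNReal.continuous_rpow_const.tendsto _).comp ?_
          have := (tendsto_const_nhds (x := m.rnDeriv P₀ x)).min ENNReal.tendsto_nat_nhds_top
          simpa using this
      simp_rw [hsup]
      rw [lintegral_iSup (fun n => (hgm n).pow_const _) ?_]
      · exact iSup_le key
      · intro i j hij x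
        exact ENNReal.rpow_le_rpow (min_le_min_left _ (by exact_mod_cast hij)) hspos.le
    refine ⟨hmeas.ennreal_toReal.aestronglyMeasurable, ?_⟩
    have hq0 : q ≠ 0 := (zero_lt_one.trans_le hq1).ne'
    rw [eLpNorm_lt_top_iff_lintegral_rpow_enorm_lt_top hq0 hqtop]
    refine lt_of_le_of_lt ?_ (ENNReal.rpow_lt_top_of_nonneg hspos.le (ENNReal.coe_ne_top (r := C)))
    refine le_trans (lintegral_mono fun x => ?_) hlim
    refine ENNReal.rpow_le_rpow ?_ hspos.le
    rw [Real.enorm_of_nonneg ENNReal.toReal_nonneg]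
    exact ENNReal.ofReal_toReal_le

/-- Riesz representation of positive normalized functionals on `L_p`. -/
lemma exists_probDual_of_functional (hp : p ≠ ∞) (l : Lp ℝ p P₀ →L[ℝ] ℝ)
    (hpos : ∀ φ, 0 ≤ φ → 0 ≤ l φ) (hone : l (Lp.const p P₀ 1) = 1) :
    ∃ μ : ProbDual p P₀, ∀ φ, pairing φ μ = l φ := by
  have hp1 : 1 ≤ p := Fact.out
  have hp0 : p ≠ 0 := (zero_lt_one.trans_le hp1).ne'
  let ind : ∀ B : Set X, MeasurableSet B → Lp ℝ p P₀ :=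
    fun B hB => indicatorConstLp p hB (measure_ne_top P₀ B) (1 : ℝ)
  have ind_nonneg : ∀ B hB, 0 ≤ l (ind B hB) := by
    intro B hB
    refine hpos _ ?_
    rw [← Lp.coeFn_nonneg]
    filter_upwards [indicatorConstLp_coeFn (p := p) (hs := hB) (hμs := measure_ne_top P₀ B)
      (c := (1 : ℝ))] with x hx
    rw [hx]
    exact Set.indicator_nonneg (fun _ _ => zero_le_one) _
  have hUnion : ∀ ⦃f : ℕ → Set X⦄ (hf : ∀ i, MeasurableSet (f i)),
      Pairwise (Function.onFun Disjoint f) →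
      ENNReal.ofReal (l (ind (⋃ i, f i) (MeasurableSet.iUnion hf))) =
        ∑' i, ENNReal.ofReal (l (ind (f i) (hf i))) := by
    intro f hf hd
    have hg : ∀ n, MeasurableSet (⋃ i ∈ Finset.range n, f i) :=
      fun n => Finset.measurableSet_biUnion _ fun i _ => hf i
    have hsum : ∀ n, ∑ i ∈ Finset.range n, l (ind (f i) (hf i)) = l (ind _ (hg n)) := by
      intro n
      induction n with
      | zero =>
        have : ind (⋃ i ∈ Finset.range 0, f i) (hg 0) = 0 := by
          simp only [ind]
          rw [← indicatorConstLp_empty (p := p) (μ := P₀) (c := (1 : ℝ))]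
          congr 1
          simp
        rw [this]; simp
      | succ n ih =>
        rw [Finset.sum_range_succ, ih, ← map_add]
        congr 1
        have hdis : Disjoint (⋃ i ∈ Finset.range n, f i) (f n) := by
          simp only [Set.disjoint_iUnion_left, Finset.mem_range]
          exact fun i hi => hd hi.ne
        have := indicatorConstLp_disjoint_union (p := p) (hg n) (hf n) (measure_ne_top P₀ _)
          (measure_ne_top P₀ _) hdis (1 : ℝ)
        simp only [ind]
        rw [← this]
        congr 1
        rw [Finset.range_add_one, Finset.set_biUnion_insert, Set.union_comm]
    -- Countable additivity is the continuity of l: since p < ∞, indicators converge in L_p once the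
    -- P₀-measures of the symmetric differences tend to 0.
    have htend : Tendsto (fun n => l (ind _ (hg n))) atTop
        (𝓝 (l (ind (⋃ i, f i) (MeasurableSet.iUnion hf)))) := by
      refine (l.continuous.tendsto _).comp ?_
      refine tendsto_indicatorConstLp_set hp ?_
      have hsub : ∀ n, (⋃ i ∈ Finset.range n, f i) ⊆ ⋃ i, f i :=
        fun n => Set.iUnion₂_subset fun i _ => Set.subset_iUnion f i
      have hmono : Monotone fun n => ⋃ i ∈ Finset.range n, f i := fun a b hab =>
        Set.biUnion_subset_biUnion_left (by simpa using Finset.range_mono hab)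
      have hU : (⋃ n, ⋃ i ∈ Finset.range n, f i) = ⋃ i, f i := by
        refine Set.Subset.antisymm (Set.iUnion_subset hsub) (Set.iUnion_subset fun i => ?_)
        refine Set.Subset.trans ?_ (Set.subset_iUnion _ (i + 1))
        exact Set.subset_biUnion_of_mem (u := f) (by simp)
      have h1 := tendsto_measure_iUnion_atTop (μ := P₀) hmono
      rw [hU] at h1
      have h2 : ∀ n, P₀ (symmDiff (⋃ i ∈ Finset.range n, f i) (⋃ i, f i)) =
          P₀ (⋃ i, f i) - P₀ (⋃ i ∈ Finset.range n, f i) := by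
        intro n
        rw [Set.symmDiff_def, Set.sdiff_eq_empty.2 (hsub n), Set.empty_union,
          measure_sdiff (hsub n) (hg n).nullMeasurableSet (measure_ne_top _ _)]
      simp_rw [h2]
      have := ENNReal.Tendsto.sub (tendsto_const_nhds (x := P₀ (⋃ i, f i))) h1
        (Or.inl (measure_ne_top _ _))
      simpa using this
    have hs : HasSum (fun i => l (ind (f i) (hf i)))
        (l (ind (⋃ i, f i) (MeasurableSet.iUnion hf))) := by
      rw [hasSum_iff_tendsto_nat_of_nonneg (fun i => ind_nonneg _ _)]
      simpa only [hsum] using htend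
    rw [← hs.tsum_eq, ENNReal.ofReal_tsum_of_nonneg (fun i => ind_nonneg _ _) hs.summable]
  have hempty : ENNReal.ofReal (l (ind ∅ MeasurableSet.empty)) = 0 := by
    simp only [ind]
    rw [indicatorConstLp_empty]; simp
  let m : Measure X := Measure.ofMeasurable (fun B hB => ENNReal.ofReal (l (ind B hB)))
    hempty hUnion
  have hm : ∀ B (hB : MeasurableSet B), m B = ENNReal.ofReal (l (ind B hB)) :=
    fun B hB => Measure.ofMeasurable_apply B hB
  have hprob : IsProbabilityMeasure m := by
    refine ⟨?_⟩
    rw [hm _ MeasurableSet.univ]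
    simp only [ind]
    rw [indicatorConstLp_univ, hone, ENNReal.ofReal_one]
  have hsimple : ∀ g : SimpleFunc X NNReal, ∀ hg : MemLp (fun x => (g x : ℝ)) p P₀,
      ∫⁻ x, (g x : ℝ≥0∞) ∂m = ENNReal.ofReal (l (hg.toLp _)) ∧ 0 ≤ l (hg.toLp _) := by
    intro g
    induction g using SimpleFunc.induction with
    | const c hs =>
      rename_i s
      intro hg
      have e : hg.toLp _ = (c : ℝ) • ind s hs := by
        refine Lp.ext ?_
        filter_upwards [hg.coeFn_toLp, Lp.coeFn_smul (c : ℝ) (ind s hs),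
          indicatorConstLp_coeFn (p := p) (hs := hs) (hμs := measure_ne_top P₀ s)
          (c := (1 : ℝ))] with x h1 h2 h3
        rw [h1, h2, Pi.smul_apply, h3]
        by_cases hx : x ∈ s <;> simp [hx]
      rw [e, map_smul, smul_eq_mul]
      refine ⟨?_, mul_nonneg c.2 (ind_nonneg _ _)⟩
      have : ∀ x, ((SimpleFunc.piecewise s hs (SimpleFunc.const X c) (SimpleFunc.const X 0) x :
          NNReal) : ℝ≥0∞) = s.indicator (fun _ => (c : ℝ≥0∞)) x := by
        intro x
        by_cases hx : x ∈ s <;> simp [hx]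
      simp_rw [this]
      rw [lintegral_indicator_const hs, hm s hs, ENNReal.ofReal_mul (show (0 : ℝ) ≤ c from c.2),
        ENNReal.ofReal_coe_nnreal]
    | add hdis hf hg =>
      rename_i f g
      intro hfg
      have mf : MemLp (fun x => (f x : ℝ)) p P₀ := by
        have := (f.map ((↑) : NNReal → ℝ)).memLp_of_isFiniteMeasure p P₀
        exact this
      have mg : MemLp (fun x => (g x : ℝ)) p P₀ := by
        have := (g.map ((↑) : NNReal → ℝ)).memLp_of_isFiniteMeasure p P₀
        exact this
      have e : hfg.toLp _ = mf.toLp _ + mg.toLp _ := by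
        rw [← MemLp.toLp_add]
        congr 1
      obtain ⟨f1, f2⟩ := hf mf
      obtain ⟨g1, g2⟩ := hg mg
      rw [e, map_add]
      refine ⟨?_, add_nonneg f2 g2⟩
      rw [ENNReal.ofReal_add f2 g2, ← f1, ← g1, ← lintegral_add_left]
      · simp
      · exact f.measurable.coe_nnreal_ennreal
  -- This is the hypothesis of the converse Hölder inequality. It also makes φ ↦ ∫ φ dm Lipschitz on
  -- L_p, so that agreement with l on indicators extends by density.
  have hbound : ∀ f : X → ℝ≥0∞, Measurable f → ∫⁻ x, f x ∂m ≤ ‖l‖₊ * eLpNorm f p P₀ := by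
    intro f hf
    rw [lintegral_eq_nnreal]
    refine iSup₂_le fun g hgf => ?_
    have mg : MemLp (fun x => (g x : ℝ)) p P₀ := by
      have := (g.map ((↑) : NNReal → ℝ)).memLp_of_isFiniteMeasure p P₀
      exact this
    have : (g.map ((↑) : NNReal → ℝ≥0∞)).lintegral m = ∫⁻ x, (g x : ℝ≥0∞) ∂m := by
      rw [← SimpleFunc.lintegral_eq_lintegral]; rfl
    rw [this, (hsimple g mg).1]
    calc ENNReal.ofReal (l (mg.toLp _)) ≤ ENNReal.ofReal (‖l‖ * ‖mg.toLp _‖) :=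
          ENNReal.ofReal_le_ofReal ((le_abs_self _).trans (l.le_opNorm _))
      _ = ‖l‖₊ * eLpNorm (fun x => (g x : ℝ)) p P₀ := by
          rw [ENNReal.ofReal_mul (norm_nonneg _), Lp.norm_toLp, ENNReal.ofReal_toReal mg.2.ne,
            ofReal_norm]
          rfl
      _ ≤ _ := by
          gcongr
          refine eLpNorm_mono_enorm fun x => ?_
          simpa using hgf x
  have hdual : InDual p P₀ m := inDual_of_lintegral_le hp _ hbound
  refine ⟨⟨m, hdual⟩, fun φ => ?_⟩
  have hac := hdual.2.1
  have hint : ∀ φ : Lp ℝ p P₀, Integrable φ m := fun φ => hdual.integrable (Lp.memLp φ)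
  have hsub : ∀ φ ψ : Lp ℝ p P₀, ∫ y, φ y ∂m - ∫ y, ψ y ∂m = ∫ y, (φ - ψ : Lp ℝ p P₀) y ∂m := by
    intro φ ψ
    rw [← integral_sub (hint φ) (hint ψ)]
    refine integral_congr_ae ?_
    filter_upwards [hac.ae_le (Lp.coeFn_sub φ ψ)] with x hx
    rw [hx]; rfl
  have hcont : Continuous fun φ : Lp ℝ p P₀ => ∫ y, φ y ∂m := by
    refine (LipschitzWith.of_dist_le_mul (K := ‖l‖₊) fun φ ψ => ?_).continuous
    rw [Real.dist_eq, hsub, dist_eq_norm, ← Real.norm_eq_abs]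
    refine (norm_integral_le_lintegral_norm _).trans ?_
    refine ENNReal.toReal_le_of_le_ofReal (by positivity) ?_
    have hae : AEMeasurable (fun x => ENNReal.ofReal ‖(φ - ψ : Lp ℝ p P₀) x‖) P₀ :=
      (Lp.aestronglyMeasurable _).norm.aemeasurable.ennreal_ofReal
    rw [lintegral_congr_ae (hac.ae_le hae.ae_eq_mk)]
    refine (hbound _ hae.measurable_mk).trans ?_
    rw [eLpNorm_congr_ae hae.ae_eq_mk.symm, ENNReal.ofReal_mul (NNReal.coe_nonneg _), Lp.norm_def,
      ENNReal.ofReal_toReal (Lp.memLp _).2.ne, ENNReal.ofReal_coe_nnreal]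
    refine le_of_eq ?_
    congr 1
    · refine eLpNorm_congr_enorm_ae (Eventually.of_forall fun x => ?_)
      rw [enorm_eq_self, ofReal_norm]
  change ∫ y, φ y ∂m = l φ
  induction φ using Lp.induction hp with
  | indicatorConst c hs hμs =>
    rename_i s
    have e : (Lp.simpleFunc.indicatorConst p hs hμs.ne c : Lp ℝ p P₀) = c • ind s hs := by
      rw [Lp.simpleFunc.coe_indicatorConst]
      refine Lp.ext ?_
      filter_upwards [Lp.coeFn_smul c (ind s hs),
          indicatorConstLp_coeFn (p := p) (hs := hs) (hμs := measure_ne_top P₀ s)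
          (c := (1 : ℝ)), indicatorConstLp_coeFn (p := p) (hs := hs) (hμs := measure_ne_top P₀ s)
          (c := c)] with x h1 h2 h3
      rw [h1, Pi.smul_apply, h2, h3]
      by_cases hx : x ∈ s <;> simp [hx]
    rw [e, map_smul, smul_eq_mul]
    have : ∀ᵐ x ∂m, (c • ind s hs : Lp ℝ p P₀) x = s.indicator (fun _ => c) x := by
      refine hac.ae_le ?_
      filter_upwards [Lp.coeFn_smul c (ind s hs),
          indicatorConstLp_coeFn (p := p) (hs := hs) (hμs := measure_ne_top P₀ s)
          (c := (1 : ℝ))] with x h1 h2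
      rw [h1, Pi.smul_apply, h2]
      by_cases hx : x ∈ s <;> simp [hx]
    rw [integral_congr_ae this, integral_indicator_const _ hs, measureReal_def, hm s hs,
      ENNReal.toReal_ofReal (ind_nonneg _ _), smul_eq_mul, mul_comm]
  | add hf hg hdis h1 h2 =>
    rw [map_add, ← h1, ← h2, ← integral_add (hint _) (hint _)]
    refine integral_congr_ae ?_
    exact hac.ae_le (Lp.coeFn_add _ _)
  | isClosed => exact isClosed_eq hcont l.continuous

end LpTools

/-! ### Canonical subgradients by iterated directional derivatives -/

section Sublinear

/-- A subadditive real function which is homogeneous for natural multiples. -/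
structure NatSublinear {E : Type*} [AddCommGroup E] (s : E → ℝ) : Prop where
  add_le : ∀ φ ψ, s (φ + ψ) ≤ s φ + s ψ
  nsmul : ∀ (k : ℕ) φ, s (k • φ) = k * s φ

variable {E : Type*} [AddCommGroup E] {s : E → ℝ}

namespace NatSublinear

lemma zero (hs : NatSublinear s) : s 0 = 0 := by simpa using hs.nsmul 0 0

lemma neg_le (hs : NatSublinear s) (φ : E) : -s (-φ) ≤ s φ := by
  have := hs.add_le φ (-φ)
  rw [add_neg_cancel, hs.zero] at this
  linarith

end NatSublinear

/-- The directional derivative of a sublinear function at `φ`, in the direction `ψ`. -/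
def dirDeriv (s : E → ℝ) (φ ψ : E) : ℝ := ⨅ t : ℕ, (s (ψ + t • φ) - t * s φ)

namespace NatSublinear

lemma antitone_quotient (hs : NatSublinear s) (φ ψ : E) :
    Antitone fun t : ℕ => s (ψ + t • φ) - t * s φ := by
  refine antitone_nat_of_succ_le fun t => ?_
  have := hs.add_le (ψ + t • φ) φ
  rw [add_assoc, ← succ_nsmul] at this
  push_cast
  linarith

lemma bddBelow_quotient (hs : NatSublinear s) (φ ψ : E) :
    BddBelow (Set.range fun t : ℕ => s (ψ + t • φ) - t * s φ) := by
  refine ⟨-s (-ψ), ?_⟩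
  rintro _ ⟨t, rfl⟩
  have := hs.add_le (ψ + t • φ) (-ψ)
  rw [add_comm ψ, add_neg_cancel_right, hs.nsmul] at this
  simp only [add_comm ψ]
  linarith

lemma dirDeriv_le_quotient (hs : NatSublinear s) (φ ψ : E) (t : ℕ) :
    dirDeriv s φ ψ ≤ s (ψ + t • φ) - t * s φ := ciInf_le (hs.bddBelow_quotient φ ψ) t

lemma dirDeriv_le (hs : NatSublinear s) (φ ψ : E) : dirDeriv s φ ψ ≤ s ψ := by
  simpa using hs.dirDeriv_le_quotient φ ψ 0

/-- The term t = 1 already gives the bound. It is what forces the derivative to become linear along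
φ. -/
lemma dirDeriv_neg_self (hs : NatSublinear s) (φ : E) : dirDeriv s φ (-φ) ≤ -s φ := by
  simpa [hs.zero] using hs.dirDeriv_le_quotient φ (-φ) 1

/-- Differentiation stays within the class of sublinear functions, so it can be repeated along new
directions. -/
lemma dirDeriv (hs : NatSublinear s) (φ : E) : NatSublinear (dirDeriv s φ) where
  add_le ψ χ := by
    rw [← sub_le_iff_le_add]
    refine le_ciInf fun t => ?_
    rw [sub_le_iff_le_add, ← sub_le_iff_le_add']
    refine le_ciInf fun r => ?_
    rw [sub_le_iff_le_add']
    -- The multiples t and r used for ψ and χ add up, and the subtracted terms match exactly.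
    refine (hs.dirDeriv_le_quotient φ (ψ + χ) (t + r)).trans ?_
    have := hs.add_le (ψ + t • φ) (χ + r • φ)
    rw [show ψ + t • φ + (χ + r • φ) = ψ + χ + (t + r) • φ by rw [add_smul]; abel] at this
    push_cast
    linarith
  nsmul k ψ := by
    rcases Nat.eq_zero_or_pos k with rfl | hk
    · simp only [zero_smul, Nat.cast_zero, zero_mul, RiskAverse.dirDeriv, zero_add, hs.nsmul,
        sub_self, ciInf_const]
    have hk' : (0 : ℝ) ≤ k := k.cast_nonneg
    have hq : ∀ t : ℕ, s (k • ψ + (k * t) • φ) - (k * t : ℕ) * s φ =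
        k * (s (ψ + t • φ) - t * s φ) := by
      intro t
      rw [mul_smul, ← smul_add, hs.nsmul]
      push_cast; ring
    apply le_antisymm
    · rw [RiskAverse.dirDeriv, RiskAverse.dirDeriv, Real.mul_iInf_of_nonneg hk']
      refine le_ciInf fun t => ?_
      rw [← hq]
      exact ciInf_le (hs.bddBelow_quotient φ _) _
    · refine le_ciInf fun t => ?_
      -- The quotients decrease in t, so only multiples of k matter; there the quotient of k • ψ is
      -- k times that of ψ.
      refine le_trans ?_ (hs.antitone_quotient φ (k • ψ) (Nat.le_mul_of_pos_left t hk))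
      simp only
      rw [hq]
      exact mul_le_mul_of_nonneg_left (hs.dirDeriv_le_quotient φ ψ t) hk'

end NatSublinear

/-- Iterated directional derivatives along a sequence of directions. -/
def iterDeriv (s : E → ℝ) (φ : ℕ → E) : ℕ → E → ℝ
  | 0 => s
  | n + 1 => dirDeriv (iterDeriv s φ n) (φ n)

/-- The infimum of all iterated directional derivatives. -/
def limDeriv (s : E → ℝ) (φ : ℕ → E) (ψ : E) : ℝ := ⨅ n, iterDeriv s φ n ψ

namespace NatSublinear

lemma iterDeriv (hs : NatSublinear s) (φ : ℕ → E) (n : ℕ) : NatSublinear (iterDeriv s φ n) := by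
  induction n with
  | zero => exact hs
  | succ n ih => exact ih.dirDeriv _

lemma antitone_iterDeriv (hs : NatSublinear s) (φ : ℕ → E) (ψ : E) :
    Antitone fun n => RiskAverse.iterDeriv s φ n ψ :=
  antitone_nat_of_succ_le fun n => (hs.iterDeriv φ n).dirDeriv_le _ _

lemma bddBelow_iterDeriv (hs : NatSublinear s) (φ : ℕ → E) (ψ : E) :
    BddBelow (Set.range fun n => RiskAverse.iterDeriv s φ n ψ) := by
  refine ⟨-s (-ψ), ?_⟩
  rintro _ ⟨n, rfl⟩
  refine le_trans ?_ ((hs.iterDeriv φ n).neg_le ψ)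
  exact neg_le_neg (hs.antitone_iterDeriv φ (-ψ) (Nat.zero_le n))

lemma limDeriv_le_iterDeriv (hs : NatSublinear s) (φ : ℕ → E) (ψ : E) (n : ℕ) :
    limDeriv s φ ψ ≤ RiskAverse.iterDeriv s φ n ψ := ciInf_le (hs.bddBelow_iterDeriv φ ψ) n

lemma limDeriv (hs : NatSublinear s) (φ : ℕ → E) : NatSublinear (limDeriv s φ) where
  add_le ψ χ := by
    rw [← sub_le_iff_le_add]
    refine le_ciInf fun t => ?_
    rw [sub_le_iff_le_add, ← sub_le_iff_le_add']
    refine le_ciInf fun r => ?_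
    rw [sub_le_iff_le_add']
    refine (hs.limDeriv_le_iterDeriv φ (ψ + χ) (max t r)).trans ?_
    refine ((hs.iterDeriv φ _).add_le ψ χ).trans (add_le_add ?_ ?_)
    · exact hs.antitone_iterDeriv φ ψ (le_max_left t r)
    · exact hs.antitone_iterDeriv φ χ (le_max_right t r)
  nsmul k ψ := by
    rw [RiskAverse.limDeriv, RiskAverse.limDeriv, Real.mul_iInf_of_nonneg k.cast_nonneg]
    exact iInf_congr fun n => (hs.iterDeriv φ n).nsmul k ψ

lemma limDeriv_le (hs : NatSublinear s) (φ : ℕ → E) (ψ : E) : RiskAverse.limDeriv s φ ψ ≤ s ψ :=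
  hs.limDeriv_le_iterDeriv φ ψ 0

/-- Differentiating along φ n at stage n + 1 bounds the value at -φ n by minus the stage-n value at
φ n, and later stages only decrease. A sublinear function that is odd on a dense sequence is linear
once it is continuous. -/
lemma limDeriv_neg (hs : NatSublinear s) (φ : ℕ → E) (n : ℕ) :
    RiskAverse.limDeriv s φ (-φ n) = -RiskAverse.limDeriv s φ (φ n) := by
  apply le_antisymm
  · calc RiskAverse.limDeriv s φ (-φ n) ≤ RiskAverse.iterDeriv s φ (n + 1) (-φ n) :=
        hs.limDeriv_le_iterDeriv _ _ _
      _ ≤ -RiskAverse.iterDeriv s φ n (φ n) := (hs.iterDeriv φ n).dirDeriv_neg_self _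
      _ ≤ _ := neg_le_neg (hs.limDeriv_le_iterDeriv _ _ _)
  · have := (hs.limDeriv φ).neg_le (φ n)
    linarith

/-- The first direction loses nothing, so a function placed at index 0 has its supremum over
subgradients attained. -/
lemma limDeriv_first (hs : NatSublinear s) (φ : ℕ → E) :
    RiskAverse.limDeriv s φ (φ 0) = s (φ 0) := by
  apply le_antisymm (hs.limDeriv_le φ _)
  have h1 : RiskAverse.limDeriv s φ (-φ 0) ≤ -s (φ 0) :=
    (hs.limDeriv_le_iterDeriv φ _ 1).trans (hs.dirDeriv_neg_self _)
  rw [hs.limDeriv_neg] at h1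
  linarith

lemma dist_le {E : Type*} [NormedAddCommGroup E] {s : E → ℝ} (hs : NatSublinear s) {C : ℝ}
    (hC : ∀ φ, s φ ≤ C * ‖φ‖) (φ ψ : E) : |s φ - s ψ| ≤ C * ‖φ - ψ‖ := by
  have h1 := hs.add_le (φ - ψ) ψ
  have h2 := hs.add_le (ψ - φ) φ
  have h3 := hC (φ - ψ)
  have h4 := hC (ψ - φ)
  rw [sub_add_cancel] at h1 h2
  rw [norm_sub_rev] at h4
  rw [abs_le]
  constructor <;> linarith

lemma continuous {E : Type*} [NormedAddCommGroup E] {s : E → ℝ} (hs : NatSublinear s) {C : ℝ}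
    (hC : ∀ φ, s φ ≤ C * ‖φ‖) : Continuous s := by
  refine (LipschitzWith.of_dist_le_mul (K := C.toNNReal) fun φ ψ => ?_).continuous
  rw [Real.dist_eq, dist_eq_norm]
  refine (hs.dist_le hC φ ψ).trans ?_
  gcongr
  exact Real.le_coe_toNNReal C

/-- A bounded sublinear function dominates a continuous linear functional which agrees with it
at the first member of a dense sequence. -/
lemma exists_linear_eq_limDeriv {E : Type*} [NormedAddCommGroup E] [NormedSpace ℝ E] {s : E → ℝ}
    (hs : NatSublinear s) {C : ℝ} (hC : ∀ φ, s φ ≤ C * ‖φ‖) {φ : ℕ → E} (hφ : DenseRange φ) :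
    ∃ l : E →L[ℝ] ℝ, ∀ ψ, l ψ = RiskAverse.limDeriv s φ ψ := by
  have hL := hs.limDeriv φ
  have hcont := hL.continuous fun ψ => (hs.limDeriv_le φ ψ).trans (hC ψ)
  have hneg : ∀ ψ, RiskAverse.limDeriv s φ (-ψ) = -RiskAverse.limDeriv s φ ψ := by
    intro ψ
    refine hφ.induction_on (p := fun ψ => RiskAverse.limDeriv s φ (-ψ) =
      -RiskAverse.limDeriv s φ ψ) ψ (isClosed_eq (hcont.comp continuous_neg) hcont.neg) ?_
    exact hs.limDeriv_neg φ
  -- Subadditivity together with oddness gives additivity, and an additive continuous map is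
  -- real-linear.
  let f : E →+ ℝ := AddMonoidHom.mk' (RiskAverse.limDeriv s φ) (fun ψ χ => by
    refine le_antisymm (hL.add_le ψ χ) ?_
    have := hL.add_le (-ψ) (-χ)
    rw [← neg_add, hneg, hneg, hneg] at this
    linarith)
  exact ⟨f.toRealLinearMap hcont, fun ψ => rfl⟩

end NatSublinear

lemma measurable_dirDeriv {A : Type*} [MeasurableSpace A] [MeasurableSpace E] [MeasurableAdd₂ E]
    {s : A → E → ℝ} (hs : Measurable fun z : A × E => s z.1 z.2) (φ : E) :
    Measurable fun z : A × E => dirDeriv (s z.1) φ z.2 := by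
  refine Measurable.iInf fun t => ?_
  refine Measurable.sub ?_ (measurable_const.mul ?_)
  · exact hs.comp (measurable_fst.prodMk (measurable_snd.add measurable_const))
  · exact hs.comp (measurable_fst.prodMk measurable_const)

/-- The construction uses only countable infima and fixed directions, so the subgradient depends
measurably on the parameter. This is the reason for restricting to natural multiples and one
sequence of directions. -/
lemma measurable_limDeriv {A : Type*} [MeasurableSpace A] [MeasurableSpace E] [MeasurableAdd₂ E]
    {s : A → E → ℝ} (hs : Measurable fun z : A × E => s z.1 z.2) (φ : ℕ → E) :
    Measurable fun z : A × E => limDeriv (s z.1) φ z.2 := by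
  refine Measurable.iInf fun n => ?_
  induction n with
  | zero => exact hs
  | succ n ih => exact measurable_dirDeriv (s := fun a => iterDeriv (s a) φ n) ih _

end Sublinear

/-! ### Continuity and attained dual representation of risk transition mappings -/

section RiskTransition

set_option linter.unusedSectionVars false

variable {X : Type*} [MeasurableSpace X] {p : ℝ≥0∞} [Fact (1 ≤ p)] {P₀ : Measure X}
  [IsProbabilityMeasure P₀]

instance : BorelSpace (Lp ℝ p P₀) := ⟨rfl⟩

lemma measurable_probDual {A : Type*} [MeasurableSpace A] {f : A → ProbDual p P₀}
    (h : Measurable fun a => (f a).1) : Measurable f := by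
  rintro _ ⟨s, hs, rfl⟩
  exact h hs

lemma toV_coeFn {f : X → ℝ} (hf : MemLp f p P₀) : toV p P₀ f =ᵐ[P₀] f := by
  rw [toV, dif_pos hf]; exact hf.coeFn_toLp

lemma toV_eq_toLp {f : X → ℝ} (hf : MemLp f p P₀) : toV p P₀ f = hf.toLp f := dif_pos hf

lemma toV_add {f g : X → ℝ} (hf : MemLp f p P₀) (hg : MemLp g p P₀) :
    toV p P₀ (fun x => f x + g x) = toV p P₀ f + toV p P₀ g := by
  rw [toV_eq_toLp hf, toV_eq_toLp hg, ← MemLp.toLp_add]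
  exact toV_eq_toLp (hf.add hg)

lemma toV_sub {f g : X → ℝ} (hf : MemLp f p P₀) (hg : MemLp g p P₀) :
    toV p P₀ (fun x => f x - g x) = toV p P₀ f - toV p P₀ g := by
  rw [toV_eq_toLp hf, toV_eq_toLp hg, ← MemLp.toLp_sub]
  exact toV_eq_toLp (hf.sub hg)

lemma toV_const_mul {f : X → ℝ} (hf : MemLp f p P₀) (a : ℝ) :
    toV p P₀ (fun x => a * f x) = a • toV p P₀ f := by
  rw [toV_eq_toLp hf, ← MemLp.toLp_const_smul]
  exact toV_eq_toLp (hf.const_mul a)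

lemma toV_const (a : ℝ) : toV p P₀ (fun _ => a) = Lp.const p P₀ a := by
  rw [toV_eq_toLp (memLp_const a)]; rfl

lemma toV_mono {f g : X → ℝ} (hf : MemLp f p P₀) (hg : MemLp g p P₀) (h : ∀ x, f x ≤ g x) :
    toV p P₀ f ≤ toV p P₀ g := by
  rw [← Lp.coeFn_le]
  filter_upwards [toV_coeFn hf, toV_coeFn hg] with x h1 h2
  rw [h1, h2]; exact h x

lemma pairing_toV (m : ProbDual p P₀) {f : X → ℝ} (hf : MemLp f p P₀) :
    pairing (toV p P₀ f) m = ∫ y, f y ∂m.1 :=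
  integral_congr_ae (m.2.2.1.ae_le (toV_coeFn hf))

/-- In a second countable space an open set is a countable union of balls around a dense sequence
with radii 1/(k+1). -/
lemma measurable_of_dist {A E : Type*} [MeasurableSpace A] [PseudoMetricSpace E]
    [SecondCountableTopology E] [MeasurableSpace E] [BorelSpace E] {f : A → E}
    (h : ∀ e, Measurable fun a => dist (f a) e) : Measurable f := by
  refine measurable_of_isOpen fun O hO => ?_
  rcases isEmpty_or_nonempty E with hE | hE
  · rw [Set.eq_empty_of_isEmpty O]; simp
  let d := TopologicalSpace.denseSeq E
  have : f ⁻¹' O = ⋃ (n : ℕ) (k : ℕ) (_ : Metric.ball (d n) (1 / (k + 1 : ℝ)) ⊆ O),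
      {a | dist (f a) (d n) < 1 / (k + 1 : ℝ)} := by
    ext a
    simp only [Set.mem_preimage, Set.mem_iUnion, Set.mem_ofPred_eq, exists_prop]
    constructor
    · intro ha
      obtain ⟨ε, hε, hb⟩ := Metric.isOpen_iff.1 hO _ ha
      obtain ⟨k, hk⟩ := exists_nat_one_div_lt (half_pos hε)
      obtain ⟨n, hn⟩ := (TopologicalSpace.denseRange_denseSeq E).exists_dist_lt (f a)
        (Nat.one_div_pos_of_nat (α := ℝ) (n := k))
      refine ⟨n, k, fun e he => hb ?_, hn⟩
      rw [Metric.mem_ball] at he ⊢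
      have := dist_triangle e (d n) (f a)
      rw [dist_comm (d n)] at this
      simp only [d] at *
      linarith
    · rintro ⟨n, k, hb, ha⟩
      exact hb ha
  rw [this]
  refine MeasurableSet.iUnion fun n => MeasurableSet.iUnion fun k => MeasurableSet.iUnion fun _ => ?_
  exact measurableSet_lt (h _) measurable_const

/-- Since L_p is separable, it is enough that distances to fixed elements are measurable, and these
are parametric integrals. -/
lemma measurable_toV (hp : p ≠ ∞) [MeasurableSpace.CountablyGenerated X] {A : Type*}
    [MeasurableSpace A] {f : A → X → ℝ} (hf : Measurable fun z : A × X => f z.1 z.2)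
    (hm : ∀ a, MemLp (f a) p P₀) : Measurable fun a => toV p P₀ (f a) := by
  have : Fact (p ≠ ∞) := ⟨hp⟩
  have hp0 : p ≠ 0 := (zero_lt_one.trans_le (Fact.out : 1 ≤ p)).ne'
  refine measurable_of_dist fun e => ?_
  obtain ⟨g, hg, hge⟩ := (Lp.aestronglyMeasurable e).aemeasurable
  have : ∀ a, dist (toV p P₀ (f a)) e =
      ((∫⁻ x, ‖f a x - g x‖ₑ ^ p.toReal ∂P₀) ^ (1 / p.toReal)).toReal := by
    intro a
    rw [dist_eq_norm, Lp.norm_def, ← eLpNorm_eq_lintegral_rpow_enorm_toReal hp0 hp]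
    congr 1
    refine eLpNorm_congr_ae ?_
    filter_upwards [Lp.coeFn_sub (toV p P₀ (f a)) e, toV_coeFn (hm a), hge] with x h1 h2 h3
    rw [h1, Pi.sub_apply, h2, h3]
  simp_rw [this]
  refine ((Measurable.lintegral_prod_right' (f := fun z : A × X =>
    ‖f z.1 z.2 - g z.2‖ₑ ^ p.toReal) ?_).pow_const _).ennreal_toReal
  exact (hf.sub (hg.comp measurable_snd)).enorm.pow_const _

/-- Dominated convergence in `L_p`. -/
lemma tendsto_toV (hp : p ≠ ∞) {f : ℕ → X → ℝ} {g b : X → ℝ} (hf : ∀ n, MemLp (f n) p P₀)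
    (hg : MemLp g p P₀) (hb : MemLp b p P₀) (hle : ∀ n x, |f n x| ≤ b x)
    (h : ∀ x, Tendsto (fun n => f n x) atTop (𝓝 (g x))) :
    Tendsto (fun n => toV p P₀ (f n)) atTop (𝓝 (toV p P₀ g)) := by
  have hp1 : 1 ≤ p := Fact.out
  rw [toV_eq_toLp hg]
  simp_rw [fun n => toV_eq_toLp (hf n)]
  rw [Lp.tendsto_Lp_iff_tendsto_eLpNorm'']
  refine tendsto_Lp_finite_of_tendsto_ae hp1 hp (fun n => (hf n).1) hg ?_
    (Eventually.of_forall h)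
  intro ε hε
  obtain ⟨δ, hδ, hh⟩ := (unifIntegrable_const (ι := Unit) hp1 hp hb) hε
  refine ⟨δ, hδ, fun n s hs hμs => le_trans ?_ (hh () s hs hμs)⟩
  refine eLpNorm_mono fun x => ?_
  by_cases hx : x ∈ s
  · simp only [hx, Set.indicator_of_mem, Real.norm_eq_abs]
    exact (hle n x).trans (le_abs_self _)
  · simp [hx]

variable {σ : Lp ℝ p P₀ → X → ProbDual p P₀ → ℝ}

namespace IsRiskTransition

lemma add_le (hσ : IsRiskTransition σ) (x : X) (m : ProbDual p P₀) (φ ψ : Lp ℝ p P₀) :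
    σ (φ + ψ) x m ≤ σ φ x m + σ ψ x m := by
  have h1 := hσ.convex x m φ ψ (1 / 2) (by norm_num) (by norm_num)
  have h2 := hσ.pos_homogeneous x m ((1 / 2 : ℝ) • φ + (1 - 1 / 2 : ℝ) • ψ) 2 (by norm_num)
  have : (2 : ℝ) • ((1 / 2 : ℝ) • φ + (1 - 1 / 2 : ℝ) • ψ) = φ + ψ := by
    rw [smul_add, smul_smul, smul_smul]; norm_num
  rw [this] at h2
  rw [h2]; linarith

lemma natSublinear (hσ : IsRiskTransition σ) (x : X) (m : ProbDual p P₀) :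
    NatSublinear fun φ => σ φ x m where
  add_le := hσ.add_le x m
  nsmul k φ := by
    rw [← Nat.cast_smul_eq_nsmul ℝ]
    exact hσ.pos_homogeneous x m φ k k.cast_nonneg

lemma zero (hσ : IsRiskTransition σ) (x : X) (m : ProbDual p P₀) : σ 0 x m = 0 :=
  (hσ.natSublinear x m).zero

/-- Monotone sublinear functionals on a Banach lattice are automatically bounded: otherwise a
convergent series of positive elements would have infinite risk. -/
lemma exists_bound (hσ : IsRiskTransition σ) (x : X) (m : ProbDual p P₀) :
    ∃ C, ∀ φ, σ φ x m ≤ C * ‖φ‖ := by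
  by_contra! hcon
  choose φ hφ using fun n : ℕ => hcon (4 ^ n)
  have hpos : ∀ n, 0 < ‖φ n‖ := by
    intro n
    rw [norm_pos_iff]
    rintro h
    have := hφ n
    rw [h, hσ.zero] at this
    simp at this
  -- The norms 2^(-n) are summable, while the excess factor 4^n makes the risk of each term at least
  -- 2^n. The sum dominates every term.
  let ψ : ℕ → Lp ℝ p P₀ := fun n => ((1 / 2) ^ n * ‖φ n‖⁻¹) • |φ n|
  have hnorm : ∀ n, ‖ψ n‖ = (1 / 2) ^ n := by
    intro n
    rw [norm_smul, norm_abs_eq_norm, norm_mul, norm_inv, norm_norm, mul_assoc,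
      inv_mul_cancel₀ (hpos n).ne', mul_one]
    simp
  have hψ0 : ∀ n, 0 ≤ ψ n := by
    intro n
    have h1 : (0 : Lp ℝ p P₀) ≤ |φ n| := abs_nonneg _
    rw [← Lp.coeFn_nonneg] at h1 ⊢
    filter_upwards [h1, Lp.coeFn_smul ((1 / 2) ^ n * ‖φ n‖⁻¹) |φ n|] with x hx h2
    rw [h2]
    exact mul_nonneg (by positivity) hx
  have hsum : Summable ψ := by
    refine Summable.of_norm ?_
    simp_rw [hnorm]
    exact summable_geometric_two
  have hle : ∀ n : ℕ, (2 : ℝ) ^ n ≤ σ (∑' k, ψ k) x m := by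
    intro n
    refine le_trans ?_ (hσ.mono x m _ _ (hsum.le_tsum n fun k _ => hψ0 k))
    rw [hσ.pos_homogeneous x m _ _ (by positivity)]
    have h1 : 4 ^ n * ‖φ n‖ ≤ σ |φ n| x m :=
      (hφ n).le.trans (hσ.mono x m _ _ (le_abs_self _))
    calc (2 : ℝ) ^ n = ((1 / 2) ^ n * ‖φ n‖⁻¹) * (4 ^ n * ‖φ n‖) := by
          have : (4 : ℝ) ^ n = 2 ^ n * 2 ^ n := by rw [← mul_pow]; norm_num
          have := (hpos n).ne'
          field_simp
          rw [‹(4 : ℝ) ^ n = _›]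
          field_simp
          rw [← mul_pow]; norm_num
      _ ≤ _ := mul_le_mul_of_nonneg_left h1 (by positivity)
  obtain ⟨n, hn⟩ := pow_unbounded_of_one_lt (σ (∑' k, ψ k) x m) (one_lt_two (α := ℝ))
  exact absurd (hle n) (not_le.2 hn)

lemma continuous (hσ : IsRiskTransition σ) (x : X) (m : ProbDual p P₀) :
    Continuous fun φ => σ φ x m := by
  obtain ⟨C, hC⟩ := hσ.exists_bound x m
  exact (hσ.natSublinear x m).continuous hC

lemma pairing_le (hσ : IsRiskTransition σ) {x : X} {m μ : ProbDual p P₀} (hμ : μ ∈ riskSet σ x m)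
    (φ : Lp ℝ p P₀) : pairing φ μ ≤ σ φ x m := by
  have := hμ φ
  rwa [hσ.zero, zero_add] at this

/-- The maximum in the dual representation of a risk transition mapping is attained by a
measurable selector. -/
theorem exists_measurable_selector (hσ : IsRiskTransition σ) (hp : p ≠ ∞)
    [MeasurableSpace.CountablyGenerated X] {m : X → ProbDual p P₀} (hm : Measurable m)
    (φ : Lp ℝ p P₀) :
    ∃ μ : X → ProbDual p P₀, Measurable μ ∧
      ∀ x, μ x ∈ riskSet σ x (m x) ∧ pairing φ (μ x) = σ φ x (m x) := by
  have : Fact (p ≠ ∞) := ⟨hp⟩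
  -- Putting φ first makes the limiting subgradient attain σ at φ; the remaining dense sequence
  -- makes it linear.
  let d : ℕ → Lp ℝ p P₀ := fun n => Nat.casesOn n φ (TopologicalSpace.denseSeq (Lp ℝ p P₀))
  have hd : DenseRange d := by
    refine (TopologicalSpace.denseRange_denseSeq (Lp ℝ p P₀)).mono ?_
    rintro _ ⟨n, rfl⟩
    exact ⟨n + 1, rfl⟩
  let s : X → Lp ℝ p P₀ → ℝ := fun x ψ => σ ψ x (m x)
  have hs : ∀ x, NatSublinear (s x) := fun x => hσ.natSublinear x (m x)
  have hex : ∀ x, ∃ μ : ProbDual p P₀, ∀ ψ, pairing ψ μ = limDeriv (s x) d ψ := by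
    intro x
    obtain ⟨C, hC⟩ := hσ.exists_bound x (m x)
    obtain ⟨l, hl⟩ := (hs x).exists_linear_eq_limDeriv hC hd
    have hle : ∀ ψ, l ψ ≤ σ ψ x (m x) := fun ψ => (hl ψ).trans_le ((hs x).limDeriv_le d ψ)
    have hc : ∀ a : ℝ, σ (Lp.const p P₀ a) x (m x) = a := by
      intro a
      have := hσ.translation x (m x) 0 a
      rwa [add_zero, hσ.zero, add_zero] at this
    -- Positivity follows from l(-ψ) ≤ σ(-ψ) ≤ 0 for ψ ≥ 0, and normalization from testing the
    -- constants 1 and -1.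
    obtain ⟨μ, hμ⟩ := exists_probDual_of_functional hp l (fun ψ hψ => by
        have h1 := (hle (-ψ)).trans (hσ.mono x (m x) (-ψ) 0 (neg_nonpos.2 hψ))
        rw [hσ.zero, map_neg] at h1
        linarith) (by
        have h1 := hle (Lp.const p P₀ 1)
        have h2 := hle (Lp.const p P₀ (-1))
        rw [hc] at h1 h2
        rw [map_neg, map_neg] at h2
        linarith)
    exact ⟨μ, fun ψ => (hμ ψ).trans (hl ψ)⟩
  choose μ hμ using hex
  refine ⟨μ, ?_, fun x => ⟨fun ψ => ?_, ?_⟩⟩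
  · refine measurable_probDual ?_
    refine Measure.measurable_of_measurable_coe _ fun B hB => ?_
    have hmeas : Measurable fun x => limDeriv (s x) d (toV p P₀ (B.indicator fun _ => 1)) := by
      have h1 : Measurable fun z : X × Lp ℝ p P₀ => s z.1 z.2 :=
        hσ.measurable.comp (measurable_snd.prodMk (measurable_fst.prodMk (hm.comp measurable_fst)))
      exact (measurable_limDeriv h1 d).comp (measurable_id.prodMk measurable_const)
    have hB1 : MemLp (B.indicator fun _ => (1 : ℝ)) p P₀ := (memLp_const 1).indicator hB
    have : ∀ x, (μ x).1 B =
        ENNReal.ofReal (limDeriv (s x) d (toV p P₀ (B.indicator fun _ => 1))) := by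
      intro x
      have := (μ x).2.1
      rw [← hμ, pairing_toV _ hB1, integral_indicator_const _ hB, smul_eq_mul, mul_one,
        ofReal_measureReal]
    simp only [this]
    exact hmeas.ennreal_ofReal
  · rw [hμ, hσ.zero, zero_add]
    exact (hs x).limDeriv_le d ψ
  · rw [hμ]
    exact (hs x).limDeriv_first d

lemma exists_mem_riskSet (hσ : IsRiskTransition σ) (hp : p ≠ ∞)
    [MeasurableSpace.CountablyGenerated X] (x : X) (m : ProbDual p P₀) (φ : Lp ℝ p P₀) :
    ∃ μ ∈ riskSet σ x m, pairing φ μ = σ φ x m := by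
  obtain ⟨μ, -, h⟩ := hσ.exists_measurable_selector hp (measurable_const (a := m)) φ
  exact ⟨μ x, h x⟩

end IsRiskTransition

end RiskTransition

/-! ### Measurable selection of minimizers -/

section MeasurableArgmin

set_option linter.unusedSectionVars false

variable {X 𝒰 : Type*} [TopologicalSpace X] [TopologicalSpace.MetrizableSpace X]
  [SecondCountableTopology X] [MeasurableSpace X] [BorelSpace X]
  [TopologicalSpace 𝒰] [TopologicalSpace.MetrizableSpace 𝒰] [SecondCountableTopology 𝒰]
  [MeasurableSpace 𝒰] [BorelSpace 𝒰]

/-- A multifunction with nonempty compact values for which the projections of closed subsets of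
its graph are measurable. -/
structure IsCompactMultifunction (K : X → Set 𝒰) : Prop where
  nonempty : ∀ x, (K x).Nonempty
  isCompact : ∀ x, IsCompact (K x)
  measurable : ∀ D : Set (X × 𝒰), IsClosed D → MeasurableSet {x | ∃ u ∈ K x, (x, u) ∈ D}

/-- The minimizers of `F x` over `K x`. -/
def argminOn (K : X → Set 𝒰) (F : X → 𝒰 → ℝ) (x : X) : Set 𝒰 :=
  {u | u ∈ K x ∧ ∀ v ∈ K x, F x u ≤ F x v}

/-- The sublevel sets of `F` are relatively closed in the graph of `K`. -/
def ClosedSublevels (K : X → Set 𝒰) (F : X → 𝒰 → ℝ) : Prop :=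
  ∀ a : ℝ, ∃ D : Set (X × 𝒰), IsClosed D ∧ ∀ x, ∀ u ∈ K x, F x u ≤ a ↔ (x, u) ∈ D

lemma measurableSet_exists_mem_isOpen {K : X → Set 𝒰}
    (h : ∀ O : Set 𝒰, IsOpen O → MeasurableSet {x | (K x ∩ O).Nonempty})
    {O : Set (X × 𝒰)} (hO : IsOpen O) : MeasurableSet {x | ∃ u ∈ K x, (x, u) ∈ O} := by
  have hb := (TopologicalSpace.isBasis_countableBasis X).prod
    (TopologicalSpace.isBasis_countableBasis 𝒰)
  have : {x | ∃ u ∈ K x, (x, u) ∈ O} = ⋃ A ∈ TopologicalSpace.countableBasis X,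
      ⋃ B ∈ TopologicalSpace.countableBasis 𝒰, ⋃ (_ : A ×ˢ B ⊆ O),
        A ∩ {x | (K x ∩ B).Nonempty} := by
    ext x
    simp only [Set.mem_iUnion, Set.mem_ofPred_eq, Set.mem_inter_iff, exists_prop]
    constructor
    · rintro ⟨u, hu, hxu⟩
      obtain ⟨_, ⟨A, hA, B, hB, rfl⟩, hm, hs⟩ := hb.exists_subset_of_mem_open hxu hO
      exact ⟨A, hA, B, hB, hs, hm.1, u, hu, hm.2⟩
    · rintro ⟨A, -, B, -, hs, hx, u, hu, huB⟩
      exact ⟨u, hu, hs ⟨hx, huB⟩⟩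
  rw [this]
  refine MeasurableSet.biUnion (TopologicalSpace.countable_countableBasis X) fun A hA =>
    MeasurableSet.biUnion (TopologicalSpace.countable_countableBasis 𝒰) fun B hB =>
    MeasurableSet.iUnion fun _ => MeasurableSet.inter ?_ (h B ?_)
  · exact (TopologicalSpace.isOpen_of_mem_countableBasis hA).measurableSet
  · exact TopologicalSpace.isOpen_of_mem_countableBasis hB

/-- By compactness of K x, its graph section meets D exactly when it meets every thickening of D;
the thickenings are open, so a countable base reduces them to the hypothesis. -/
lemma IsCompactMultifunction.of_measurable {K : X → Set 𝒰} (hne : ∀ x, (K x).Nonempty)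
    (hc : ∀ x, IsCompact (K x))
    (h : ∀ O : Set 𝒰, IsOpen O → MeasurableSet {x | (K x ∩ O).Nonempty}) :
    IsCompactMultifunction K where
  nonempty := hne
  isCompact := hc
  measurable D hD := by
    let _ := TopologicalSpace.metrizableSpaceMetric (X × 𝒰)
    have hδ : ∀ n : ℕ, (0 : ℝ) < 1 / (n + 1) := fun n => Nat.one_div_pos_of_nat
    have : {x | ∃ u ∈ K x, (x, u) ∈ D} =
        ⋂ n : ℕ, {x | ∃ u ∈ K x, (x, u) ∈ Metric.thickening (1 / (n + 1 : ℝ)) D} := by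
      ext x
      simp only [Set.mem_iInter, Set.mem_ofPred_eq]
      constructor
      · rintro ⟨u, hu, hD⟩ n
        exact ⟨u, hu, Metric.self_subset_thickening (hδ n) D hD⟩
      · intro hx
        let S : ℕ → Set 𝒰 := fun n =>
          K x ∩ (fun u => (x, u)) ⁻¹' Metric.cthickening (1 / (n + 1 : ℝ)) D
        have hcl : ∀ n : ℕ, IsClosed ((fun u : 𝒰 => (x, u)) ⁻¹'
            Metric.cthickening (1 / (n + 1 : ℝ)) D) := fun n =>
          Metric.isClosed_cthickening.preimage (Continuous.prodMk_right x)
        obtain ⟨u, hu⟩ := IsCompact.nonempty_iInter_of_sequence_nonempty_isCompact_isClosed S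
          (fun n u hu => ⟨hu.1, Metric.cthickening_mono
            (Nat.one_div_le_one_div (Nat.le_succ n)) _ hu.2⟩)
          (fun n => by
            obtain ⟨u, hu, hm⟩ := hx n
            exact ⟨u, hu, Metric.thickening_subset_cthickening _ _ hm⟩)
          ((hc x).inter_right (hcl 0))
          (fun n => (hc x).isClosed.inter (hcl n))
        rw [Set.mem_iInter] at hu
        refine ⟨u, (hu 0).1, ?_⟩
        rw [← hD.closure_eq, Metric.closure_eq_iInter_cthickening' D
          (Set.range fun n : ℕ => 1 / (n + 1 : ℝ))]
        · simp only [Set.mem_iInter]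
          rintro _ ⟨n, rfl⟩
          exact (hu n).2
        · intro ε hε
          obtain ⟨n, hn⟩ := exists_nat_one_div_lt hε
          exact ⟨_, ⟨n, rfl⟩, hδ n, hn.le⟩
    rw [this]
    exact MeasurableSet.iInter fun n => measurableSet_exists_mem_isOpen h Metric.isOpen_thickening

lemma ClosedSublevels.exists_min {K : X → Set 𝒰} {F : X → 𝒰 → ℝ} (hF : ClosedSublevels K F)
    {x : X} {S : Set 𝒰} (hS : IsCompact S) (hSK : S ⊆ K x) (hne : S.Nonempty) :
    ∃ u ∈ S, ∀ v ∈ S, F x u ≤ F x v := by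
  have hl : LowerSemicontinuousOn (F x) S := by
    intro u hu a ha
    obtain ⟨D, hD, h⟩ := hF a
    have h1 : ∀ᶠ v in 𝓝 u, (x, v) ∉ D :=
      (hD.preimage (Continuous.prodMk_right x)).isOpen_compl.eventually_mem
        (fun h' => not_le.2 ha ((h x u (hSK hu)).2 h'))
    filter_upwards [h1.filter_mono nhdsWithin_le_nhds, self_mem_nhdsWithin] with v hv hvS
    exact not_le.1 fun h' => hv ((h x v (hSK hvS)).1 h')
  obtain ⟨u, hu, h⟩ := hl.exists_isMinOn hne hS
  exact ⟨u, hu, fun v hv => h hv⟩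

/-- The class is stable under passing to minimizers, so argmin operations can be iterated. -/
lemma IsCompactMultifunction.argminOn {K : X → Set 𝒰} (hK : IsCompactMultifunction K)
    {F : X → 𝒰 → ℝ} (hF : ClosedSublevels K F) : IsCompactMultifunction (argminOn K F) where
  nonempty x := by
    obtain ⟨u, hu, h⟩ := hF.exists_min (hK.isCompact x) subset_rfl (hK.nonempty x)
    exact ⟨u, hu, h⟩
  isCompact x := by
    obtain ⟨u, hu, h⟩ := hF.exists_min (hK.isCompact x) subset_rfl (hK.nonempty x)
    obtain ⟨D, hD, h'⟩ := hF (F x u)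
    have : RiskAverse.argminOn K F x = K x ∩ (fun v => (x, v)) ⁻¹' D := by
      ext v
      constructor
      · rintro ⟨hv, hm⟩
        exact ⟨hv, (h' x v hv).1 (hm u hu)⟩
      · rintro ⟨hv, hm⟩
        exact ⟨hv, fun r hr => ((h' x v hv).2 hm).trans (h r hr)⟩
    rw [this]
    exact (hK.isCompact x).inter_right (hD.preimage (Continuous.prodMk_right x))
  measurable D hD := by
    choose E hE hFE using hF
    have hcl : ∀ x, ∀ C : Set (X × 𝒰), IsClosed C →
        IsCompact (K x ∩ (fun v => (x, v)) ⁻¹' C) := fun x C hC =>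
      (hK.isCompact x).inter_right (hC.preimage (Continuous.prodMk_right x))
    -- A minimizer lies in D exactly when every rational level q above the minimum is reached inside
    -- D. The complement term covers the levels not above the minimum.
    have : {x | ∃ u ∈ RiskAverse.argminOn K F x, (x, u) ∈ D} =
        ⋂ q : ℚ, ({x | ∃ u ∈ K x, (x, u) ∈ D ∩ E q} ∪
          (⋃ (r : ℚ) (_ : r < q), {x | ∃ u ∈ K x, (x, u) ∈ E r})ᶜ) := by
      ext x
      simp only [Set.mem_iInter, Set.mem_union, Set.mem_compl_iff, Set.mem_iUnion,
        Set.mem_ofPred_eq, exists_prop, not_exists, not_and]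
      constructor
      · rintro ⟨u, ⟨hu, hm⟩, huD⟩ q
        by_cases hq : F x u ≤ q
        · exact Or.inl ⟨u, hu, huD, (hFE q x u hu).1 hq⟩
        · refine Or.inr fun r hr v hv hvE => hq ?_
          have h1 := (hFE r x v hv).2 hvE
          have h2 : (r : ℝ) < q := by exact_mod_cast hr
          linarith [hm v hv]
      · intro h
        obtain ⟨u, hu, hmin⟩ := ClosedSublevels.exists_min (fun a => ⟨E a, hE a, hFE a⟩)
          (hK.isCompact x) subset_rfl (hK.nonempty x)
        have key : ∀ q : ℚ, F x u < q → ∃ v ∈ K x, (x, v) ∈ D ∧ F x v ≤ q := by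
          intro q hq
          rcases h q with ⟨v, hv, hvD, hvE⟩ | h'
          · exact ⟨v, hv, hvD, (hFE q x v hv).2 hvE⟩
          · obtain ⟨r, hr1, hr2⟩ := exists_rat_btwn hq
            exact absurd ((hFE r x u hu).1 hr1.le) (h' r (by exact_mod_cast hr2) u hu)
        obtain ⟨q, hq⟩ := exists_rat_gt (F x u)
        obtain ⟨v₀, hv₀, hv₀D, -⟩ := key q hq
        obtain ⟨v, ⟨hv, hvD⟩, hvmin⟩ := ClosedSublevels.exists_min
          (fun a => ⟨E a, hE a, hFE a⟩) (hcl x D hD) Set.inter_subset_left ⟨v₀, hv₀, hv₀D⟩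
        refine ⟨v, ⟨hv, fun r hr => le_trans ?_ (hmin r hr)⟩, hvD⟩
        by_contra! hlt
        obtain ⟨q, hq1, hq2⟩ := exists_rat_btwn hlt
        obtain ⟨y, hy, hyD, hyq⟩ := key q hq1
        exact absurd (hvmin y ⟨hy, hyD⟩) (not_le.2 (hyq.trans_lt hq2))
    rw [this]
    refine MeasurableSet.iInter fun q => (hK.measurable _ (hD.inter (hE q))).union ?_
    exact (MeasurableSet.iUnion fun r : ℚ => MeasurableSet.iUnion fun _ =>
      hK.measurable _ (hE r)).compl

/-- Measurable selection of minimizers. -/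
theorem IsCompactMultifunction.exists_measurable_argmin {K : X → Set 𝒰}
    (hK : IsCompactMultifunction K) {F : X → 𝒰 → ℝ} (hF : ClosedSublevels K F) :
    ∃ π : X → 𝒰, Measurable π ∧ ∀ x, π x ∈ K x ∧ ∀ v ∈ K x, F x (π x) ≤ F x v := by
  rcases isEmpty_or_nonempty X with hX | ⟨⟨x₀⟩⟩
  · exact ⟨fun x => hX.elim x, measurable_of_empty _, fun x => hX.elim x⟩
  have : Nonempty 𝒰 := (hK.nonempty x₀).to_type
  let _ := TopologicalSpace.metrizableSpaceMetric 𝒰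
  let d := TopologicalSpace.denseSeq 𝒰
  -- Ties are broken by minimizing successively the distances to a dense sequence. Two points in all
  -- the L n x have equal distances to that sequence and therefore coincide.
  let L : ℕ → X → Set 𝒰 := fun n => Nat.rec (RiskAverse.argminOn K F)
    (fun n L => RiskAverse.argminOn L fun _ u => dist u (d n)) n
  have hL0 : L 0 = RiskAverse.argminOn K F := rfl
  have hLs : ∀ n, L (n + 1) = RiskAverse.argminOn (L n) fun _ u => dist u (d n) := fun n => rfl
  have hcs : ∀ n, ClosedSublevels (L n) fun _ u => dist u (d n) := fun n a =>
    ⟨{z | dist z.2 (d n) ≤ a}, isClosed_le (continuous_snd.dist continuous_const)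
      continuous_const, fun x u _ => Iff.rfl⟩
  have hL : ∀ n, IsCompactMultifunction (L n) := by
    intro n
    induction n with
    | zero => exact hK.argminOn hF
    | succ n ih => exact ih.argminOn (hcs n)
  have hanti : ∀ n x, L (n + 1) x ⊆ L n x := fun n x u hu => hu.1
  have hex : ∀ x, ∃ u, ∀ n, u ∈ L n x := by
    intro x
    obtain ⟨u, hu⟩ := IsCompact.nonempty_iInter_of_sequence_nonempty_isCompact_isClosed
      (fun n => L n x) (fun n => hanti n x) (fun n => (hL n).nonempty x) ((hL 0).isCompact x)
      (fun n => ((hL n).isCompact x).isClosed)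
    exact ⟨u, Set.mem_iInter.1 hu⟩
  choose π hπ using hex
  have huniq : ∀ x u, (∀ n, u ∈ L n x) → u = π x := by
    intro x u hu
    have hd : ∀ n, dist u (d n) = dist (π x) (d n) := fun n =>
      le_antisymm ((hu (n + 1)).2 _ (hπ x n)) ((hπ x (n + 1)).2 _ (hu n))
    have hcl : ∀ v, dist u v = dist (π x) v := fun v =>
      (TopologicalSpace.denseRange_denseSeq 𝒰).induction_on
        (p := fun v => dist u v = dist (π x) v) v
        (isClosed_eq (continuous_const.dist continuous_id) (continuous_const.dist continuous_id)) hd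
    exact dist_eq_zero.1 ((hcl (π x)).trans (dist_self _))
  refine ⟨π, measurable_of_isClosed fun C hC => ?_, fun x => hπ x 0⟩
  have : π ⁻¹' C = ⋂ n, {x | ∃ u ∈ L n x, (x, u) ∈ (Set.univ : Set X) ×ˢ C} := by
    ext x
    simp only [Set.mem_preimage, Set.mem_iInter, Set.mem_ofPred_eq, Set.mem_prod, Set.mem_univ,
      true_and]
    constructor
    · exact fun h n => ⟨π x, hπ x n, h⟩
    · intro h
      obtain ⟨u, hu⟩ := IsCompact.nonempty_iInter_of_sequence_nonempty_isCompact_isClosed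
        (fun n => L n x ∩ C) (fun n => Set.inter_subset_inter_left _ (hanti n x))
        h (((hL 0).isCompact x).inter_right hC)
        (fun n => ((hL n).isCompact x).isClosed.inter hC)
      rw [Set.mem_iInter] at hu
      rw [← huniq x u fun n => (hu n).1]
      exact (hu 0).2
  rw [this]
  exact MeasurableSet.iInter fun n => (hL n).measurable _ (isClosed_univ.prod hC)

end MeasurableArgmin

/-! ### Lower semicontinuity of the one-step risk -/

section LowerSemicontinuity

set_option linter.unusedSectionVars false

variable {X : Type*} [MeasurableSpace X] [TopologicalSpace X] {p : ℝ≥0∞} [Fact (1 ≤ p)]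
  {P₀ : Measure X} [IsProbabilityMeasure P₀] {σ : Lp ℝ p P₀ → X → ProbDual p P₀ → ℝ}

namespace IsRiskTransition

/-- Take μ attaining σ(φ, x, m). The set {ν | a < ⟨φ, ν⟩} is a weak* open neighbourhood of μ, so
lower semicontinuity of 𝒜 puts a competitor with pairing above a into 𝒜(xₖ, mₖ). -/
lemma eventually_lt (hσ : IsRiskTransition σ) (hp : p ≠ ∞) [MeasurableSpace.CountablyGenerated X]
    (h2 : RiskSetLSC σ) {xs : ℕ → X} {ms : ℕ → ProbDual p P₀} {x : X} {m : ProbDual p P₀}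
    (hx : Tendsto xs atTop (𝓝 x)) (hm : Tendsto ms atTop (𝓝 m)) {φ : Lp ℝ p P₀} {a : ℝ}
    (ha : a < σ φ x m) : ∀ᶠ k in atTop, a < σ φ (xs k) (ms k) := by
  obtain ⟨μ, hμ, h⟩ := hσ.exists_mem_riskSet hp x m φ
  have hcont : Continuous fun ν : ProbDual p P₀ => pairing φ ν :=
    (continuous_apply φ).comp (continuous_induced_dom
      (f := fun (ν : ProbDual p P₀) (φ : Lp ℝ p P₀) => pairing φ ν))
  have hO : IsOpen {ν : ProbDual p P₀ | a < pairing φ ν} := isOpen_lt continuous_const hcont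
  filter_upwards [h2 xs ms x m hx hm μ hμ _ hO (show a < pairing φ μ by rwa [h])] with k hk
  obtain ⟨ν, hν, hνO⟩ := hk
  exact lt_of_lt_of_le hνO (hσ.pairing_le hν φ)

lemma eventually_lt_of_pointwise (hσ : IsRiskTransition σ) (hp : p ≠ ∞)
    [MeasurableSpace.CountablyGenerated X]
    (h2 : RiskSetLSC σ) {xs : ℕ → X} {ms : ℕ → ProbDual p P₀} {x : X} {m : ProbDual p P₀}
    (hx : Tendsto xs atTop (𝓝 x)) (hm : Tendsto ms atTop (𝓝 m))
    {f : ℕ → X → ℝ} {g b : X → ℝ} (hfm : ∀ k, Measurable (f k)) (hgm : Measurable g)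
    (hf : ∀ k, MemLp (f k) p P₀) (hg : MemLp g p P₀) (hb : MemLp b p P₀)
    (hbf : ∀ k y, -b y ≤ f k y) (hbg : ∀ y, -b y ≤ g y)
    (hlsc : ∀ y, ∀ a < g y, ∀ᶠ k in atTop, a < f k y) {a : ℝ}
    (ha : a < σ (toV p P₀ g) x m) :
    ∀ᶠ k in atTop, a < σ (toV p P₀ (f k)) (xs k) (ms k) := by
  -- The tail infimum, capped by g, lies below f j for all j ≥ k and tends to g under a common
  -- integrable bound. Fixing one k with risk above a reduces the claim to a function that does not
  -- move along the sequence.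
  let r : ℕ → X → ℝ := fun k y => min (g y) (⨅ j, f (k + j) y)
  have hbdd : ∀ k y, BddBelow (Set.range fun j => f (k + j) y) := by
    rintro k y
    exact ⟨-b y, by rintro _ ⟨j, rfl⟩; exact hbf _ y⟩
  have hrm : ∀ k, Measurable (r k) := fun k => hgm.min (Measurable.iInf fun j => hfm _)
  have hr_lower : ∀ k y, -b y ≤ r k y := fun k y => le_min (hbg y) (le_ciInf fun j => hbf _ y)
  have hr_le : ∀ k y, |r k y| ≤ |g y| + |b y| := by
    intro k y
    have h1 := hr_lower k y
    have h2 : r k y ≤ g y := min_le_left _ _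
    have := le_abs_self (b y)
    have := le_abs_self (g y)
    have := abs_nonneg (b y)
    have := abs_nonneg (g y)
    rw [abs_le]; constructor <;> linarith
  have hdom : MemLp (fun y => |g y| + |b y|) p P₀ := hg.abs.add hb.abs
  have hr : ∀ k, MemLp (r k) p P₀ := fun k =>
    hdom.mono (hrm k).aestronglyMeasurable (Eventually.of_forall fun y => by
      rw [Real.norm_eq_abs, Real.norm_eq_abs]
      exact (hr_le k y).trans (le_abs_self _))
  have hlim : ∀ y, Tendsto (fun k => r k y) atTop (𝓝 (g y)) := by
    intro y
    refine tendsto_order.2 ⟨fun c hc => ?_, fun c hc => Eventually.of_forall fun k =>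
      (min_le_left _ _).trans_lt hc⟩
    obtain ⟨d, hcd, hdg⟩ := exists_between hc
    obtain ⟨k₀, hk₀⟩ := eventually_atTop.1 (hlsc y d hdg)
    filter_upwards [eventually_ge_atTop k₀] with k hk
    refine hcd.trans_le (le_min hdg.le (le_ciInf fun j => (hk₀ _ (by omega)).le))
  have h3 := ((hσ.continuous x m).tendsto _).comp (tendsto_toV hp hr hg hdom hr_le hlim)
  obtain ⟨k, hk⟩ := (h3.eventually_const_lt ha).exists
  filter_upwards [hσ.eventually_lt hp h2 hx hm hk, eventually_ge_atTop k] with j hj hkj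
  refine hj.trans_le (hσ.mono _ _ _ _ (toV_mono (hr k) (hf j) fun y => ?_))
  refine (min_le_right _ _).trans ?_
  have := ciInf_le (hbdd k y) (j - k)
  rwa [Nat.add_sub_cancel' hkj] at this

end IsRiskTransition

end LowerSemicontinuity

namespace Model

/-! ### Existence of measurable minimizing decision rules -/

section Minimizer

set_option linter.unusedSectionVars false

variable {X 𝒰 : Type*}
    [TopologicalSpace X] [TopologicalSpace.MetrizableSpace X] [SecondCountableTopology X]
    [MeasurableSpace X] [BorelSpace X]
    [TopologicalSpace 𝒰] [TopologicalSpace.MetrizableSpace 𝒰] [SecondCountableTopology 𝒰]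
    [MeasurableSpace 𝒰] [BorelSpace 𝒰]
    {G : Model X 𝒰} {p : ℝ≥0∞} [Fact (1 ≤ p)] {P₀ : Measure X} [IsProbabilityMeasure P₀]
    {σ : Lp ℝ p P₀ → X → ProbDual p P₀ → ℝ} {w : X → ℝ}

/-- The risk `σ(f, x, Q(x, u))` of a function `f`. -/
def risk (h0 : G.G0 p P₀) (σ : Lp ℝ p P₀ → X → ProbDual p P₀ → ℝ) (f : X → ℝ)
    (z : G.Graph) : ℝ := σ (toV p P₀ f) z.1.1 (q h0 z)

lemma continuous_q {h0 : G.G0 p P₀} (h1 : G1 h0) : Continuous (q h0) :=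
  continuous_induced_rng.2 (continuous_pi h1)

lemma exists_cost_bound (h3 : G.G3 w) (hw : ∀ x, 1 ≤ w x) :
    ∃ C, 0 ≤ C ∧ ∀ x, ∀ u ∈ G.U x, ∀ y, |G.c x u y| ≤ C * (w x + w y) := by
  obtain ⟨C, hC⟩ := h3.2.1
  refine ⟨max C 0, le_max_right _ _, fun x u hu y => (hC x u hu y).trans ?_⟩
  have := hw x
  have := hw y
  exact mul_le_mul_of_nonneg_right (le_max_left _ _) (by linarith)

/-- The cost truncated from below at `-(n + C w(y))`. -/
def truncCost (G : Model X 𝒰) (w : X → ℝ) (C n : ℝ) (z : X × 𝒰) (y : X) : ℝ :=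
  max (G.c z.1 z.2 y) (-(n + C * w y))

lemma measurable_truncCost (h3 : G.G3 w) (hwm : Measurable w) (C n : ℝ) (z : X × 𝒰) :
    Measurable (G.truncCost w C n z) := by
  have h : Measurable fun y : X => (z.1, z.2, y) :=
    measurable_const.prodMk (measurable_const.prodMk measurable_id)
  have h' : Measurable fun y : X => G.c z.1 z.2 y := h3.1.comp h
  have h'' : Measurable fun y : X => -(n + C * w y) :=
    ((hwm.const_mul C).const_add n).neg
  unfold truncCost
  exact h'.max h''

lemma memLp_truncCost (h3 : G.G3 w) (hwm : Measurable w) (hw : ∀ x, 1 ≤ w x)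
    (hwp : MemLp w p P₀) {C n : ℝ} (hC0 : 0 ≤ C) (hn : 0 ≤ n)
    (hC : ∀ x, ∀ u ∈ G.U x, ∀ y, |G.c x u y| ≤ C * (w x + w y)) (z : G.Graph) :
    MemLp (G.truncCost w C n z.1) p P₀ := by
  have hd : MemLp (fun y => (C * w z.1.1 + n) + C * w y) p P₀ :=
    (memLp_const (C * w z.1.1 + n)).add (hwp.const_mul C)
  refine hd.mono (measurable_truncCost h3 hwm C n z.1).aestronglyMeasurable
    (Eventually.of_forall fun y => ?_)
  rw [Real.norm_eq_abs, Real.norm_eq_abs]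
  refine le_trans ?_ (le_abs_self _)
  have h1 := abs_le.1 (hC z.1.1 z.1.2 z.2 y)
  have h2 : 0 ≤ C * w z.1.1 := mul_nonneg hC0 (by linarith [hw z.1.1])
  have h3 : 0 ≤ C * w y := mul_nonneg hC0 (by linarith [hw y])
  rw [truncCost, abs_le]
  constructor
  · exact le_max_of_le_right (by linarith)
  · exact max_le (by linarith) (by linarith)

/-- The truncation gives the minorant -(n + C w(y) + |v(y)|), the same for all points of a
convergent sequence. The original bound involves w(x), which need not be locally bounded. -/
lemma isClosed_sublevel_truncCost (hσ : IsRiskTransition σ) (hp : p ≠ ∞) (h2 : RiskSetLSC σ)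
    {h0 : G.G0 p P₀} (h1 : G1 h0) (h3 : G.G3 w) (hwm : Measurable w) (hw : ∀ x, 1 ≤ w x)
    (hwp : MemLp w p P₀) {C n : ℝ} (hC0 : 0 ≤ C) (hn : 0 ≤ n)
    (hC : ∀ x, ∀ u ∈ G.U x, ∀ y, |G.c x u y| ≤ C * (w x + w y))
    {v : X → ℝ} (hvm : Measurable v) (hvp : MemLp v p P₀) (a : ℝ) :
    IsClosed {z : G.Graph | risk h0 σ (fun y => G.truncCost w C n z.1 y + v y) z ≤ a} := by
  refine IsSeqClosed.isClosed fun zs z hzs hz => ?_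
  rw [Set.mem_ofPred_eq]
  by_contra! hlt
  have hfm : ∀ z : X × 𝒰, Measurable fun y => G.truncCost w C n z y + v y := fun z =>
    (measurable_truncCost h3 hwm C n z).add hvm
  have hf : ∀ z : G.Graph, MemLp (fun y => G.truncCost w C n z.1 y + v y) p P₀ := fun z =>
    (memLp_truncCost h3 hwm hw hwp hC0 hn hC z).add hvp
  have hlow : ∀ (z : X × 𝒰) y, -((n + C * w y) + |v y|) ≤ G.truncCost w C n z y + v y := by
    intro z y
    have h1 : -(n + C * w y) ≤ G.truncCost w C n z y := le_max_right _ _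
    have := neg_abs_le (v y)
    linarith
  have hz1 : Tendsto (fun k => (zs k).1) atTop (𝓝 z.1) := (continuous_subtype_val.tendsto z).comp hz
  have key := hσ.eventually_lt_of_pointwise hp h2 (xs := fun k => (zs k).1.1)
    (ms := fun k => q h0 (zs k)) ((continuous_fst.tendsto _).comp hz1)
    (((continuous_q h1).tendsto z).comp hz)
    (f := fun k y => G.truncCost w C n (zs k).1 y + v y)
    (g := fun y => G.truncCost w C n z.1 y + v y) (b := fun y => (n + C * w y) + |v y|)
    (fun k => hfm _) (hfm _) (fun k => hf _) (hf z)
    (((memLp_const n).add (hwp.const_mul C)).add hvp.abs) (fun k => hlow _) (hlow _)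
    (fun y b hb => by
      by_cases hcase : b - v y < -(n + C * w y)
      · refine Eventually.of_forall fun k => ?_
        have : -(n + C * w y) ≤ G.truncCost w C n (zs k).1 y := le_max_right _ _
        linarith
      · have hb' : b - v y < G.c z.1.1 z.1.2 y := by
          have h4 : b - v y < G.truncCost w C n z.1 y := by linarith
          rcases lt_max_iff.1 h4 with h | h
          · exact h
          · exact absurd h hcase
        filter_upwards [hz1.eventually (h3.2.2 y z.1 _ hb')] with k hk
        have : G.c (zs k).1.1 (zs k).1.2 y ≤ G.truncCost w C n (zs k).1 y := le_max_left _ _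
        linarith) hlt
  obtain ⟨k, hk⟩ := key.exists
  exact absurd (hzs k) (not_le.2 hk)

theorem exists_isMinimizer (hσ : IsRiskTransition σ) (hp : p ≠ ∞) (h2 : RiskSetLSC σ)
    {h0 : G.G0 p P₀} (h1 : G1 h0) (h3 : G.G3 w) (h4 : G.G4) (hwm : Measurable w)
    (hw : ∀ x, 1 ≤ w x) (hwp : MemLp w p P₀) {v : X → ℝ} (hvm : Measurable v)
    (hvp : MemLp v p P₀) : ∃ π : G.Rule, IsMinimizer h0 σ v π := by
  classical
  obtain ⟨C, hC0, hC⟩ := exists_cost_bound h3 hw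
  have hU : IsCompactMultifunction G.U := .of_measurable G.U_nonempty h4 G.U_measurable
  let F : ℕ → X → 𝒰 → ℝ := fun n x u => if h : u ∈ G.U x then
    risk h0 σ (fun y => G.truncCost w C n (x, u) y + v y) ⟨(x, u), h⟩ else 0
  have hF : ∀ n, ClosedSublevels G.U (F n) := by
    intro n a
    obtain ⟨D, hD, h⟩ := isClosed_induced_iff.1 (isClosed_sublevel_truncCost hσ hp h2 h1 h3 hwm hw
      hwp hC0 n.cast_nonneg hC hvm hvp a)
    refine ⟨D, hD, fun x u hu => ?_⟩
    have := Set.ext_iff.1 h ⟨(x, u), hu⟩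
    rw [Set.mem_preimage, Set.mem_ofPred_eq] at this
    simp only [F, dif_pos hu]
    exact this.symm
  choose π hπm hπ using fun n => hU.exists_measurable_argmin (hF n)
  -- At truncation level N x ≥ C w(x) the truncation does not change the cost at x. Selectors for
  -- the countably many levels are therefore glued along N.
  let N : X → ℕ := fun x => ⌈C * w x⌉₊
  have hN : Measurable N := (hwm.const_mul C).nat_ceil
  have hm : Measurable fun x => π (N x) x :=
    (measurable_from_prod_countable_right (f := fun z : ℕ × X => π z.1 z.2) hπm).comp
      (hN.prodMk measurable_id)
  have heq : ∀ z : G.Graph, stageRisk h0 σ v z = F (N z.1.1) z.1.1 z.1.2 := by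
    rintro ⟨⟨x, u⟩, hu⟩
    simp only [F, dif_pos hu, stageRisk, risk]
    congr 3
    funext y
    congr 1
    refine (max_eq_left ?_).symm
    have h5 := abs_le.1 (hC x u hu y)
    have : C * w x ≤ N x := Nat.le_ceil _
    linarith
  refine ⟨⟨fun x => π (N x) x, hm, fun x => (hπ (N x) x).1⟩, fun z => ?_⟩
  rw [heq, heq z]
  exact (hπ (N z.1.1) z.1.1).2 _ z.2

end Minimizer

end Model

/-! ### Compositions of selectors of a multikernel -/

section SelectorPowers

variable {Y : Type*} [MeasurableSpace Y]

/-- `P` is a composition of `k + 1` measurable selectors of `𝔐`. -/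
def IsSelectorComp (𝔐 : Y → Set (Measure Y)) : ℕ → Kernel Y Y → Prop
  | 0, P => IsSelector P 𝔐
  | k + 1, P => ∃ N P' : Kernel Y Y, IsSelector N 𝔐 ∧ IsSelectorComp 𝔐 k P' ∧ P = N ∘ₖ P'

lemma IsSelectorComp.isSelector {𝔐 : Y → Set (Measure Y)} {k : ℕ} {P : Kernel Y Y}
    (h : IsSelectorComp 𝔐 k P) : IsSelector P (mpow 𝔐 (k + 1)) := by
  induction k generalizing P with
  | zero => exact h
  | succ k ih =>
    obtain ⟨N, P', hN, hP', rfl⟩ := h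
    exact fun y => ⟨P', N, ih hP', hN, rfl⟩

/-- Powers append new factors at the end, whereas backward recursion of risks prepends them.
Associativity reconciles the two for genuine compositions of kernels. -/
lemma IsSelectorComp.comp {𝔐 : Y → Set (Measure Y)} {k : ℕ} {P N : Kernel Y Y}
    (h : IsSelectorComp 𝔐 k P) (hN : IsSelector N 𝔐) : IsSelectorComp 𝔐 (k + 1) (P ∘ₖ N) := by
  induction k generalizing P with
  | zero => exact ⟨P, N, h, hN, rfl⟩
  | succ k ih =>
    obtain ⟨N', P', hN', hP', rfl⟩ := h
    exact ⟨N', P' ∘ₖ N, hN', ih hP', Kernel.comp_assoc _ _ _⟩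

end SelectorPowers

namespace Model

/-! ### Iterated risks of the weight and uniform transience -/

section Transience

set_option linter.unusedSectionVars false

variable {X 𝒰 : Type*} [MeasurableSpace X] [TopologicalSpace 𝒰] [MeasurableSpace 𝒰]
    {G : Model X 𝒰} {p : ℝ≥0∞} [Fact (1 ≤ p)] {P₀ : Measure X} [IsProbabilityMeasure P₀]
    {σ : Lp ℝ p P₀ → X → ProbDual p P₀ → ℝ} {w : X → ℝ} {h0 : G.G0 p P₀}

lemma risk_mono (hσ : IsRiskTransition σ) {f g : X → ℝ} (hf : MemLp f p P₀) (hg : MemLp g p P₀)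
    (h : ∀ x, f x ≤ g x) (z : G.Graph) : risk h0 σ f z ≤ risk h0 σ g z :=
  hσ.mono _ _ _ _ (toV_mono hf hg h)

lemma risk_const_add (hσ : IsRiskTransition σ) {f : X → ℝ} (hf : MemLp f p P₀) (a : ℝ)
    (z : G.Graph) : risk h0 σ (fun y => a + f y) z = a + risk h0 σ f z := by
  rw [risk, toV_add (memLp_const a) hf, toV_const]
  exact hσ.translation _ _ _ _

lemma risk_const (hσ : IsRiskTransition σ) (a : ℝ) (z : G.Graph) :
    risk h0 σ (fun _ => a) z = a := by
  have := hσ.translation z.1.1 (q h0 z) 0 a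
  rw [add_zero, hσ.zero, add_zero] at this
  rw [risk, toV_const, this]

lemma risk_const_mul (hσ : IsRiskTransition σ) {f : X → ℝ} (hf : MemLp f p P₀) {a : ℝ}
    (ha : 0 ≤ a) (z : G.Graph) : risk h0 σ (fun y => a * f y) z = a * risk h0 σ f z := by
  rw [risk, toV_const_mul hf]
  exact hσ.pos_homogeneous _ _ _ _ ha

lemma risk_nonneg (hσ : IsRiskTransition σ) {f : X → ℝ} (hf : MemLp f p P₀) (h : ∀ x, 0 ≤ f x)
    (z : G.Graph) : 0 ≤ risk h0 σ f z := by
  rw [← risk_const hσ 0 z]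
  exact risk_mono hσ (memLp_const 0) hf h z

lemma risk_sub_le (hσ : IsRiskTransition σ) {f g d : X → ℝ} (hf : MemLp f p P₀)
    (hg : MemLp g p P₀) (hd : MemLp d p P₀) (h : ∀ y, f y - g y ≤ d y) (z : G.Graph) :
    risk h0 σ f z - risk h0 σ g z ≤ risk h0 σ d z := by
  have h1 := hσ.add_le z.1.1 (q h0 z) (toV p P₀ fun y => f y - g y) (toV p P₀ g)
  rw [toV_sub hf hg, sub_add_cancel, ← toV_sub hf hg] at h1
  have h2 := risk_mono (h0 := h0) hσ (hf.sub hg) hd h z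
  have h3 : risk h0 σ (f - g) z = σ (toV p P₀ fun y => f y - g y) z.1.1 (q h0 z) := rfl
  rw [h3] at h2
  rw [risk, risk]
  linarith

lemma abs_risk_sub_le (hσ : IsRiskTransition σ) {f g d : X → ℝ} (hf : MemLp f p P₀)
    (hg : MemLp g p P₀) (hd : MemLp d p P₀) (h : ∀ y, |f y - g y| ≤ d y) (z : G.Graph) :
    |risk h0 σ f z - risk h0 σ g z| ≤ risk h0 σ d z := by
  rw [abs_sub_le_iff]
  exact ⟨risk_sub_le hσ hf hg hd (fun y => (abs_le.1 (h y)).2) z,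
    risk_sub_le hσ hg hf hd (fun y => by linarith [(abs_le.1 (h y)).1]) z⟩

/-- Law invariance enters here: under the point mass at the absorbing state, f has the law of the
constant f(x_A). The class of f modulo P₀ determines this value, since Q ≪ P₀ makes x_A an atom of
P₀. -/
lemma risk_absorbing [MeasurableSingletonClass X] (hσ : IsRiskTransition σ) {f : X → ℝ}
    (hf : MemLp f p P₀) (z : G.Graph) (hz : z.1.1 = G.xA) : risk h0 σ f z = f G.xA := by
  obtain ⟨⟨x, u⟩, hu⟩ := z
  simp only at hz
  subst hz
  rw [← risk_const (h0 := h0) hσ (f G.xA) ⟨(G.xA, u), hu⟩, risk, risk]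
  refine hσ.law_invariant _ _ _ _ _ fun η => ?_
  set m := q h0 ⟨(G.xA, u), hu⟩
  have := m.2.1
  have hac : m.1 ≪ P₀ := m.2.2.1
  have hA : ∀ᵐ y ∂m.1, y = G.xA := by
    have h1 : m.1 {G.xA} = 1 := G.Q_absorbing u hu
    have h2 := (prob_compl_eq_zero_iff (μ := m.1) (measurableSet_singleton G.xA)).2 h1
    exact h2
  refine measure_congr ?_
  filter_upwards [hA, hac.ae_le (toV_coeFn hf),
    hac.ae_le (toV_coeFn (memLp_const (p := p) (μ := P₀) (f G.xA)))] with y h1 h2 h3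
  apply propext
  change toV p P₀ f y ≤ η ↔ toV p P₀ (fun _ => f G.xA) y ≤ η
  rw [h2, h3, h1]

lemma measurable_at (π : G.Rule) : Measurable π.at :=
  (measurable_id.prodMk π.2.1).subtype_mk

lemma measurable_q_at (h0 : G.G0 p P₀) (π : G.Rule) : Measurable fun x => q h0 (π.at x) :=
  measurable_probDual (G.Q.measurable.comp (measurable_at π))

lemma measurable_risk (hσ : IsRiskTransition σ) (hp : p ≠ ∞)
    [MeasurableSpace.CountablyGenerated X] (π : G.Rule) {f : X → X → ℝ}
    (hf : Measurable fun z : X × X => f z.1 z.2) (hm : ∀ x, MemLp (f x) p P₀) :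
    Measurable fun x => risk h0 σ (f x) (π.at x) :=
  hσ.measurable.comp ((measurable_toV hp hf hm).prodMk
    (measurable_id.prodMk (measurable_q_at h0 π)))

/-- The risk of a nonnegative function vanishing at the absorbing state is its integral with
respect to some measurable selector of the effective multikernel. -/
lemma exists_effSelector (hσ : IsRiskTransition σ) (hp : p ≠ ∞) [MeasurableSingletonClass X]
    [MeasurableSpace.CountablyGenerated X] (h0 : G.G0 p P₀) (π : G.Rule) {f : X → ℝ}
    (hfp : MemLp f p P₀) (hnn : ∀ x, 0 ≤ f x) (hA : f G.xA = 0) :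
    ∃ N : Kernel {x : X // x ≠ G.xA} {x : X // x ≠ G.xA},
      IsSelector N (effMultikernel h0 σ π) ∧
      ∀ x, ∫⁻ y, ENNReal.ofReal (f y.1) ∂(N x) = ENNReal.ofReal (risk h0 σ f (π.at x.1)) := by
  obtain ⟨μ, hμm, hμ⟩ := hσ.exists_measurable_selector hp (measurable_q_at h0 π) (toV p P₀ f)
  have hset : MeasurableSet {x : X | x ≠ G.xA} := (measurableSet_singleton G.xA).compl
  have hval : Measurable (Subtype.val : ProbDual p P₀ → Measure X) := comap_measurable _
  let κ : Kernel X X := ⟨fun x => (μ x).1, hval.comp hμm⟩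
  let N : Kernel {x : X // x ≠ G.xA} {x : X // x ≠ G.xA} :=
    (κ.comap Subtype.val measurable_subtype_coe).comapRight
      (MeasurableEmbedding.subtype_coe hset)
  refine ⟨N, fun x => ⟨(μ x.1).1, ⟨μ x.1, (hμ x.1).1, rfl⟩, ?_⟩, fun x => ?_⟩
  · rfl
  · change ∫⁻ y : {x : X | x ≠ G.xA}, ENNReal.ofReal (f y.1) ∂((μ x.1).1.comap Subtype.val) = _
    rw [lintegral_subtype_comap hset fun y => ENNReal.ofReal (f y), ← lintegral_indicator hset]
    -- As f vanishes at x_A, restricting the maximizing measure to the effective state space does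
    -- not change the integral.
    have : ({x : X | x ≠ G.xA}.indicator fun y => ENNReal.ofReal (f y)) =
        fun y => ENNReal.ofReal (f y) := by
      refine Set.indicator_eq_self.2 fun y hy => ?_
      rintro rfl
      simp [hA] at hy
    rw [this, ← ofReal_integral_eq_lintegral_ofReal ((μ x.1).2.integrable hfp)
      (Eventually.of_forall hnn), ← pairing_toV _ hfp, (hμ x.1).2]
    rfl

/-- The weight function outside the absorbing state. -/
def effWeight (G : Model X 𝒰) (w : X → ℝ) : X → ℝ := {x | x ≠ G.xA}.indicator w

lemma effWeight_xA : G.effWeight w G.xA = 0 := by simp [effWeight]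

lemma effWeight_of_ne {x : X} (hx : x ≠ G.xA) : G.effWeight w x = w x :=
  Set.indicator_of_mem (s := {x | x ≠ G.xA}) hx w

lemma effWeight_nonneg (hw : ∀ x, 1 ≤ w x) (x : X) : 0 ≤ G.effWeight w x :=
  Set.indicator_nonneg (fun x _ => zero_le_one.trans (hw x)) x

lemma effWeight_le (hw : ∀ x, 1 ≤ w x) (x : X) : G.effWeight w x ≤ w x :=
  Set.indicator_le_self' (fun x _ => zero_le_one.trans (hw x)) x

lemma measurable_effWeight [MeasurableSingletonClass X] (hwm : Measurable w) :
    Measurable (G.effWeight w) := hwm.indicator (measurableSet_singleton G.xA).compl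

lemma memLp_effWeight [MeasurableSingletonClass X] (hwp : MemLp w p P₀) :
    MemLp (G.effWeight w) p P₀ := hwp.indicator (measurableSet_singleton G.xA).compl

/-- Iterated risks of the effective weight function under a stationary policy. -/
def iterWeight (h0 : G.G0 p P₀) (σ : Lp ℝ p P₀ → X → ProbDual p P₀ → ℝ) (w : X → ℝ)
    (π : G.Rule) : ℕ → X → ℝ
  | 0 => G.effWeight w
  | k + 1 => fun x => risk h0 σ (iterWeight h0 σ w π k) (π.at x)

lemma memLp_of_abs_le {f : X → ℝ} (hf : Measurable f) (hwp : MemLp w p P₀) {C : ℝ}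
    (h : ∀ x, |f x| ≤ C * w x) : MemLp f p P₀ :=
  (hwp.const_mul C).mono hf.aestronglyMeasurable (Eventually.of_forall fun x =>
    (h x).trans (le_abs_self _))

variable [MeasurableSingletonClass X] [MeasurableSpace.CountablyGenerated X]

lemma exists_risk_effWeight_le (hσ : IsRiskTransition σ) (hp : p ≠ ∞)
    (hw : ∀ x, 1 ≤ w x) (hwp : MemLp w p P₀) {K : ℝ} (hK0 : 0 ≤ K)
    (hK : ∀ (π : G.Rule) (T : ℕ) (M : Kernel {x : X // x ≠ G.xA} {x : X // x ≠ G.xA}),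
      IsSelector M (msum (effMultikernel h0 σ π) T) →
        ∀ x, ∫⁻ y, ENNReal.ofReal (w y.1) ∂(M x) ≤ ENNReal.ofReal (K * w x.1))
    (π : G.Rule) (x : X) :
    risk h0 σ (G.effWeight w) (π.at x) ≤ K * G.effWeight w x := by
  have hmem : MemLp (G.effWeight w) p P₀ := memLp_effWeight hwp
  by_cases hx : x = G.xA
  · rw [risk_absorbing hσ hmem _ hx, hx, effWeight_xA, mul_zero]
  · obtain ⟨N, hN, hNi⟩ := exists_effSelector hσ hp h0 π hmem (effWeight_nonneg hw) effWeight_xA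
    have h1 := hK π 1 N (fun y => ⟨0, rfl, N y, hN y, (zero_add _).symm⟩) ⟨x, hx⟩
    have h2 : ∀ y : {x : X // x ≠ G.xA}, G.effWeight w y.1 = w y.1 := fun y =>
      effWeight_of_ne y.2
    have h3 := hNi ⟨x, hx⟩
    simp only [h2] at h3
    rw [h3, ENNReal.ofReal_le_ofReal_iff (mul_nonneg hK0 (by linarith [hw x]))] at h1
    rw [effWeight_of_ne hx]
    exact h1

/-- The geometric bound K^k is crude, K possibly exceeding 1; it secures integrability and vanishing
at x_A. Summability comes from transience with all T. -/
lemma iterWeight_props (hσ : IsRiskTransition σ) (hp : p ≠ ∞) (hwm : Measurable w)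
    (hw : ∀ x, 1 ≤ w x) (hwp : MemLp w p P₀) {K : ℝ} (hK0 : 0 ≤ K)
    (hK : ∀ (π : G.Rule) x, risk h0 σ (G.effWeight w) (π.at x) ≤ K * G.effWeight w x)
    (π : G.Rule) (k : ℕ) :
    Measurable (iterWeight h0 σ w π k) ∧ MemLp (iterWeight h0 σ w π k) p P₀ ∧
      ∀ x, 0 ≤ iterWeight h0 σ w π k x ∧
        iterWeight h0 σ w π k x ≤ K ^ k * G.effWeight w x := by
  induction k with
  | zero =>
    refine ⟨measurable_effWeight hwm, memLp_effWeight hwp, fun x => ⟨effWeight_nonneg hw x, ?_⟩⟩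
    simp [iterWeight]
  | succ k ih =>
    obtain ⟨ihm, ihp, ihx⟩ := ih
    have hm : Measurable (iterWeight h0 σ w π (k + 1)) :=
      measurable_risk hσ hp π (f := fun _ => iterWeight h0 σ w π k) (ihm.comp measurable_snd)
        fun _ => ihp
    have hx : ∀ x, 0 ≤ iterWeight h0 σ w π (k + 1) x ∧
        iterWeight h0 σ w π (k + 1) x ≤ K ^ (k + 1) * G.effWeight w x := by
      intro x
      have hmem : MemLp (G.effWeight w) p P₀ := memLp_effWeight hwp
      refine ⟨risk_nonneg hσ ihp (fun y => (ihx y).1) _, ?_⟩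
      calc risk h0 σ (iterWeight h0 σ w π k) (π.at x)
          ≤ risk h0 σ (fun y => K ^ k * G.effWeight w y) (π.at x) :=
            risk_mono hσ ihp (hmem.const_mul _) (fun y => (ihx y).2) _
        _ = K ^ k * risk h0 σ (G.effWeight w) (π.at x) :=
            risk_const_mul hσ hmem (pow_nonneg hK0 k) _
        _ ≤ K ^ k * (K * G.effWeight w x) :=
            mul_le_mul_of_nonneg_left (hK π x) (pow_nonneg hK0 k)
        _ = _ := by ring
    refine ⟨hm, memLp_of_abs_le hm hwp (C := K ^ (k + 1)) fun x => ?_, hx⟩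
    rw [abs_of_nonneg (hx x).1]
    exact (hx x).2.trans (mul_le_mul_of_nonneg_left (effWeight_le hw x) (pow_nonneg hK0 _))

/-- Under uniform risk-transience, the iterated risks of the weight function are uniformly
summable. -/
theorem exists_sum_iterWeight_le (hσ : IsRiskTransition σ) (hp : p ≠ ∞) (hwm : Measurable w)
    (hw : ∀ x, 1 ≤ w x) (hwp : MemLp w p P₀) (htrans : UniformlyRiskTransient h0 σ w) :
    ∃ K, 0 ≤ K ∧ ∀ π : G.Rule,
      (∀ k, Measurable (iterWeight h0 σ w π k) ∧ MemLp (iterWeight h0 σ w π k) p P₀) ∧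
      (∀ k x, 0 ≤ iterWeight h0 σ w π k x) ∧
      (∀ x, risk h0 σ (G.effWeight w) (π.at x) ≤ K * G.effWeight w x) ∧
      ∀ T x, ∑ k ∈ Finset.range T, iterWeight h0 σ w π k x ≤ (K + 1) * G.effWeight w x := by
  obtain ⟨K', hK'⟩ := htrans
  set K := max K' 0 with hKdef
  have hK0 : 0 ≤ K := le_max_right _ _
  have hK : ∀ (π : G.Rule) (T : ℕ) (M : Kernel {x : X // x ≠ G.xA} {x : X // x ≠ G.xA}),
      IsSelector M (msum (effMultikernel h0 σ π) T) →
        ∀ x, ∫⁻ y, ENNReal.ofReal (w y.1) ∂(M x) ≤ ENNReal.ofReal (K * w x.1) :=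
    fun π T M hM x => (hK' π T M hM x).trans (ENNReal.ofReal_le_ofReal
      (mul_le_mul_of_nonneg_right (le_max_left _ _) (by linarith [hw x.1])))
  have hone := exists_risk_effWeight_le hσ hp hw hwp hK0 hK
  have hprops := iterWeight_props hσ hp hwm hw hwp hK0 hone
  refine ⟨K, hK0, fun π => ⟨fun k => ⟨(hprops π k).1, (hprops π k).2.1⟩,
    fun k x => ((hprops π k).2.2 x).1, hone π, fun T x => ?_⟩⟩
  have hzero : ∀ k, iterWeight h0 σ w π k G.xA = 0 := by
    intro k
    have h := (hprops π k).2.2 G.xA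
    rw [effWeight_xA, mul_zero] at h
    exact le_antisymm h.2 h.1
  have hP : ∀ k, ∃ P : Kernel {x : X // x ≠ G.xA} {x : X // x ≠ G.xA},
      IsSelectorComp (effMultikernel h0 σ π) k P ∧
      ∀ y, ∫⁻ z, ENNReal.ofReal (w z.1) ∂(P y) =
        ENNReal.ofReal (iterWeight h0 σ w π (k + 1) y.1) := by
    intro k
    induction k with
    | zero =>
      obtain ⟨N, hN, hNi⟩ := exists_effSelector hσ hp h0 π (hprops π 0).2.1
        (fun x => ((hprops π 0).2.2 x).1) (hzero 0)
      refine ⟨N, hN, fun y => ?_⟩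
      rw [iterWeight, ← hNi y]
      refine lintegral_congr fun z => ?_
      rw [iterWeight, effWeight_of_ne z.2]
    | succ k ih =>
      obtain ⟨P, hP, hPi⟩ := ih
      obtain ⟨N, hN, hNi⟩ := exists_effSelector hσ hp h0 π (hprops π (k + 1)).2.1
        (fun x => ((hprops π (k + 1)).2.2 x).1) (hzero (k + 1))
      -- N is the first transition: it maximizes the risk of the (k+1)-fold iterate, which is
      -- already the integral of w under P.
      refine ⟨P ∘ₖ N, hP.comp hN, fun y => ?_⟩
      have hwY : Measurable fun z : {x : X // x ≠ G.xA} => ENNReal.ofReal (w z.1) :=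
        (hwm.comp measurable_subtype_coe).ennreal_ofReal
      rw [Kernel.lintegral_comp _ _ _ hwY]
      simp only [hPi]
      rw [hNi y]
      rfl
  choose P hPc hPi using hP
  have hM : ∀ T, ∃ M : Kernel {x : X // x ≠ G.xA} {x : X // x ≠ G.xA},
      IsSelector M (msum (effMultikernel h0 σ π) T) ∧
      ∀ y, ∫⁻ z, ENNReal.ofReal (w z.1) ∂(M y) =
        ENNReal.ofReal (∑ k ∈ Finset.range T, iterWeight h0 σ w π (k + 1) y.1) := by
    intro T
    induction T with
    | zero => exact ⟨0, fun y => rfl, fun y => by simp⟩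
    | succ T ih =>
      obtain ⟨M, hM, hMi⟩ := ih
      refine ⟨M + P T, fun y => ⟨M y, hM y, P T y, (hPc T).isSelector y, rfl⟩, fun y => ?_⟩
      rw [FunLike.coe_add, Pi.add_apply, lintegral_add_measure, hMi, hPi, Finset.sum_range_succ,
        ENNReal.ofReal_add (Finset.sum_nonneg fun k _ => ((hprops π _).2.2 _).1)
          ((hprops π _).2.2 _).1]
  have hbound : ∑ k ∈ Finset.range T, iterWeight h0 σ w π (k + 1) x ≤ K * G.effWeight w x := by
    by_cases hx : x = G.xA
    · rw [hx, effWeight_xA, mul_zero]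
      exact (Finset.sum_eq_zero fun k _ => hzero _).le
    · obtain ⟨M, hM, hMi⟩ := hM T
      have h1 := hK π T M hM ⟨x, hx⟩
      rw [hMi, ENNReal.ofReal_le_ofReal_iff (mul_nonneg hK0 (by linarith [hw x]))] at h1
      rw [effWeight_of_ne hx]
      exact h1
  -- Transience controls the terms with index at least 1; the term of index 0 is the weight itself,
  -- whence K + 1.
  have h1 : ∑ k ∈ Finset.range T, iterWeight h0 σ w π k x ≤
      ∑ k ∈ Finset.range (T + 1), iterWeight h0 σ w π k x :=
    Finset.sum_le_sum_of_subset_of_nonneg (Finset.range_mono (Nat.le_succ T))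
      fun k _ _ => ((hprops π k).2.2 x).1
  rw [Finset.sum_range_succ'] at h1
  have h2 : iterWeight h0 σ w π 0 x = G.effWeight w x := rfl
  rw [h2] at h1
  linarith

end Transience

end Model

namespace Model

/-! ### Policy evaluation, comparison and policy iteration -/

section DynamicProgramming

set_option linter.unusedSectionVars false

variable {X 𝒰 : Type*} [MeasurableSpace X] [TopologicalSpace X] [TopologicalSpace 𝒰]
    [MeasurableSpace 𝒰]
    {G : Model X 𝒰} {p : ℝ≥0∞} [Fact (1 ≤ p)] {P₀ : Measure X} [IsProbabilityMeasure P₀]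
    {σ : Lp ℝ p P₀ → X → ProbDual p P₀ → ℝ} {w : X → ℝ} {h0 : G.G0 p P₀}
    [MeasurableSingletonClass X] [MeasurableSpace.CountablyGenerated X]

/-- The standing assumptions which do not involve continuity. -/
structure IsTransientModel (h0 : G.G0 p P₀) (σ : Lp ℝ p P₀ → X → ProbDual p P₀ → ℝ)
    (w : X → ℝ) : Prop where
  risk : IsRiskTransition σ
  ne_top : p ≠ ∞
  measurable_weight : Measurable w
  one_le_weight : ∀ x, 1 ≤ w x
  memLp_weight : MemLp w p P₀
  cost : G.G3 w
  transient : UniformlyRiskTransient h0 σ w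

/-- Measurable `w`-bounded functions vanishing at the absorbing state. -/
structure IsValueFunction (G : Model X 𝒰) (w v : X → ℝ) : Prop where
  measurable : Measurable v
  bounded : WBounded w v
  zero : v G.xA = 0

/-- The dynamic programming operator of a stationary policy, applied `T` times. -/
def iterStage (h0 : G.G0 p P₀) (σ : Lp ℝ p P₀ → X → ProbDual p P₀ → ℝ) (π : G.Rule)
    (v : X → ℝ) : ℕ → X → ℝ
  | 0 => v
  | T + 1 => fun x => stageRisk h0 σ (iterStage h0 σ π v T) (π.at x)

lemma iterStage_zero_eq_finiteRisk (π : G.Rule) (T : ℕ) :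
    iterStage h0 σ π (fun _ => 0) T = finiteRisk h0 σ π T := by
  induction T with
  | zero => rfl
  | succ T ih => rw [iterStage, ih]; rfl

lemma iterStage_succ' (π : G.Rule) (v : X → ℝ) (T : ℕ) :
    iterStage h0 σ π v (T + 1) =
      iterStage h0 σ π (fun x => stageRisk h0 σ v (π.at x)) T := by
  induction T with
  | zero => rfl
  | succ T ih => rw [iterStage, ih]; rfl

lemma isValueFunction_zero (G : Model X 𝒰) (w : X → ℝ) : G.IsValueFunction w fun _ => 0 :=
  ⟨measurable_const, ⟨0, by simp⟩, rfl⟩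

namespace IsTransientModel

lemma memLp (h : IsTransientModel h0 σ w) {v : X → ℝ} (hv : Measurable v) (hb : WBounded w v) :
    MemLp v p P₀ := by
  obtain ⟨C, hC⟩ := hb
  exact memLp_of_abs_le hv h.memLp_weight hC

lemma abs_le_effWeight {v : X → ℝ} (hv : G.IsValueFunction w v) (hw : ∀ x, 1 ≤ w x) :
    ∃ C, 0 ≤ C ∧ ∀ x, |v x| ≤ C * G.effWeight w x := by
  obtain ⟨C, hC⟩ := hv.bounded
  refine ⟨max C 0, le_max_right _ _, fun x => ?_⟩
  by_cases hx : x = G.xA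
  · rw [hx, hv.zero, effWeight_xA]; simp
  · rw [effWeight_of_ne hx]
    exact (hC x).trans (mul_le_mul_of_nonneg_right (le_max_left _ _) (by linarith [hw x]))

lemma wBounded_of_effWeight (h : IsTransientModel h0 σ w) {v : X → ℝ} {C : ℝ} (hC : 0 ≤ C)
    (hv : ∀ x, |v x| ≤ C * G.effWeight w x) : WBounded w v :=
  ⟨C, fun x => (hv x).trans (mul_le_mul_of_nonneg_left (effWeight_le h.one_le_weight x) hC)⟩

lemma measurable_cost (h : IsTransientModel h0 σ w) (x : X) (u : 𝒰) : Measurable (G.c x u) := by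
  have h1 : Measurable fun y : X => (x, u, y) :=
    measurable_const.prodMk (measurable_const.prodMk measurable_id)
  exact h.cost.1.comp h1

lemma memLp_cost (h : IsTransientModel h0 σ w) (z : G.Graph) :
    MemLp (G.c z.1.1 z.1.2) p P₀ := by
  obtain ⟨C, hC⟩ := h.cost.2.1
  have hd : MemLp (fun y => C * (w z.1.1 + w y)) p P₀ :=
    ((memLp_const (w z.1.1)).add h.memLp_weight).const_mul C
  exact hd.mono (h.measurable_cost _ _).aestronglyMeasurable (Eventually.of_forall fun y =>
    (hC z.1.1 z.1.2 z.2 y).trans (le_abs_self _))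

lemma memLp_stage (h : IsTransientModel h0 σ w) {v : X → ℝ} (hv : MemLp v p P₀) (z : G.Graph) :
    MemLp (fun y => G.c z.1.1 z.1.2 y + v y) p P₀ := (h.memLp_cost z).add hv

lemma stageRisk_mono (h : IsTransientModel h0 σ w) {v v' : X → ℝ} (hv : MemLp v p P₀)
    (hv' : MemLp v' p P₀) (hle : ∀ x, v x ≤ v' x) (z : G.Graph) :
    stageRisk h0 σ v z ≤ stageRisk h0 σ v' z :=
  risk_mono h.risk (h.memLp_stage hv z) (h.memLp_stage hv' z)
    (fun y => by linarith [hle y]) z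

/-- The cost cancels in the difference, so only the risk of |v - v'| remains. -/
lemma abs_stageRisk_sub_le (h : IsTransientModel h0 σ w) {v v' d : X → ℝ} (hv : MemLp v p P₀)
    (hv' : MemLp v' p P₀) (hd : MemLp d p P₀) (hle : ∀ x, |v x - v' x| ≤ d x) (z : G.Graph) :
    |stageRisk h0 σ v z - stageRisk h0 σ v' z| ≤ Model.risk h0 σ d z :=
  abs_risk_sub_le h.risk (h.memLp_stage hv z) (h.memLp_stage hv' z) hd
    (fun y => by rw [add_sub_add_left_eq_sub]; exact hle y) z

lemma stageRisk_absorbing (h : IsTransientModel h0 σ w) {v : X → ℝ} (hv : MemLp v p P₀)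
    (z : G.Graph) (hz : z.1.1 = G.xA) : stageRisk h0 σ v z = v G.xA := by
  have h1 : stageRisk h0 σ v z = G.c z.1.1 z.1.2 G.xA + v G.xA :=
    risk_absorbing h.risk (h.memLp_stage hv z) z hz
  have h2 : G.c G.xA z.1.2 G.xA = 0 := G.c_absorbing _ (hz ▸ z.2)
  rw [h1, hz, h2, zero_add]

lemma tendsto_stageRisk (h : IsTransientModel h0 σ w) {v : ℕ → X → ℝ} {v' : X → ℝ} {C : ℝ}
    (hv : ∀ k, Measurable (v k)) (hC : ∀ k x, |v k x| ≤ C * w x)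
    (hlim : ∀ x, Tendsto (fun k => v k x) atTop (𝓝 (v' x))) (z : G.Graph) :
    Tendsto (fun k => stageRisk h0 σ (v k) z) atTop (𝓝 (stageRisk h0 σ v' z)) := by
  have hv' : Measurable v' := measurable_of_tendsto_metrizable hv (tendsto_pi_nhds.2 hlim)
  have hC' : ∀ x, |v' x| ≤ C * w x := fun x =>
    le_of_tendsto (hlim x).abs (Eventually.of_forall fun k => hC k x)
  refine ((h.risk.continuous z.1.1 (q h0 z)).tendsto _).comp
    (tendsto_toV h.ne_top (fun k => h.memLp_stage (h.memLp (hv k) ⟨C, hC k⟩) z)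
      (h.memLp_stage (h.memLp hv' ⟨C, hC'⟩) z)
      ((h.memLp_cost z).abs.add (h.memLp_weight.const_mul C)) (fun k y => ?_)
      (fun y => (hlim y).const_add _))
  exact (abs_add_le _ _).trans (add_le_add_right (hC k y) _)

/-- The one-step risks of the costs are uniformly bounded by the effective weight function. -/
lemma exists_stageRisk_zero_le (h : IsTransientModel h0 σ w) : ∃ C, 0 ≤ C ∧
    ∀ (π : G.Rule) x, |stageRisk h0 σ (fun _ => 0) (π.at x)| ≤ C * G.effWeight w x := by
  obtain ⟨C₁, hC₁⟩ := h.cost.2.1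
  obtain ⟨K, hK0, hK⟩ := exists_sum_iterWeight_le h.risk h.ne_top h.measurable_weight
    h.one_le_weight h.memLp_weight h.transient
  set C := max C₁ 0
  have hC0 : 0 ≤ C := le_max_right _ _
  have hwA : 0 ≤ w G.xA := by linarith [h.one_le_weight G.xA]
  -- The full weight is at most w(x_A) plus the effective weight. Its risk contributes w(x_A) ≤
  -- w(x_A)w(x) and K w(x), and the w(x) in the cost bound accounts for the 1.
  refine ⟨C * (1 + w G.xA + K), by positivity, fun π x => ?_⟩
  have hz : MemLp (fun _ : X => (0 : ℝ)) p P₀ := memLp_const 0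
  by_cases hx : x = G.xA
  · rw [h.stageRisk_absorbing hz _ hx, hx, effWeight_xA]; simp
  have hmem := memLp_effWeight (G := G) h.memLp_weight
  have hd : MemLp (fun y => w x + w G.xA + G.effWeight w y) p P₀ :=
    (memLp_const (w x + w G.xA)).add hmem
  have h1 : |stageRisk h0 σ (fun _ => 0) (π.at x) - Model.risk h0 σ (fun _ => 0) (π.at x)| ≤
      Model.risk h0 σ (fun y => C * (w x + w G.xA + G.effWeight w y)) (π.at x) := by
    refine abs_risk_sub_le h.risk (h.memLp_stage hz _) hz (hd.const_mul C) (fun y => ?_) _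
    have h2 : w y ≤ w G.xA + G.effWeight w y := by
      by_cases hy : y = G.xA
      · rw [hy, effWeight_xA, add_zero]
      · rw [effWeight_of_ne hy]; linarith
    have h3 : |G.c x (π.1 x) y| ≤ C * (w x + w y) :=
      (hC₁ x _ (π.2.2 x) y).trans (mul_le_mul_of_nonneg_right (le_max_left _ _)
        (by linarith [h.one_le_weight x, h.one_le_weight y]))
    rw [add_zero, sub_zero]
    exact h3.trans (mul_le_mul_of_nonneg_left (by linarith) hC0)
  rw [risk_const h.risk, sub_zero, risk_const_mul h.risk hd hC0, risk_const_add h.risk hmem] at h1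
  have h2 := (hK π).2.2.1 x
  rw [effWeight_of_ne hx] at h2 ⊢
  refine h1.trans ?_
  rw [mul_assoc]
  refine mul_le_mul_of_nonneg_left ?_ hC0
  have h3 : w G.xA ≤ w G.xA * w x := le_mul_of_one_le_right hwA (h.one_le_weight x)
  linarith

lemma isValueFunction_stageRisk (h : IsTransientModel h0 σ w) (π : G.Rule) {v : X → ℝ}
    (hv : G.IsValueFunction w v) :
    G.IsValueFunction w fun x => stageRisk h0 σ v (π.at x) := by
  have hvp := h.memLp hv.measurable hv.bounded
  obtain ⟨C₁, hC₁0, hC₁⟩ := h.exists_stageRisk_zero_le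
  obtain ⟨C₂, hC₂0, hC₂⟩ := abs_le_effWeight hv h.one_le_weight
  obtain ⟨K, hK0, hK⟩ := exists_sum_iterWeight_le h.risk h.ne_top h.measurable_weight
    h.one_le_weight h.memLp_weight h.transient
  refine ⟨?_, h.wBounded_of_effWeight (C := C₁ + C₂ * K) (by positivity) fun x => ?_, ?_⟩
  · refine measurable_risk h.risk h.ne_top π (f := fun x y => G.c x (π.1 x) y + v y) ?_
      fun x => h.memLp_stage hvp (π.at x)
    have h1 : Measurable fun z : X × X => (z.1, π.1 z.1, z.2) :=
      measurable_fst.prodMk ((π.2.1.comp measurable_fst).prodMk measurable_snd)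
    exact (h.cost.1.comp h1).add (hv.measurable.comp measurable_snd)
  · have hmem := memLp_effWeight (G := G) h.memLp_weight
    have h1 := h.abs_stageRisk_sub_le hvp (memLp_const 0) (hmem.const_mul C₂)
      (fun y => by rw [sub_zero]; exact hC₂ y) (π.at x)
    rw [risk_const_mul h.risk hmem hC₂0] at h1
    have h2 := mul_le_mul_of_nonneg_left ((hK π).2.2.1 x) hC₂0
    have h3 := abs_sub_abs_le_abs_sub (stageRisk h0 σ v (π.at x))
      (stageRisk h0 σ (fun _ => 0) (π.at x))
    have h4 := hC₁ π x
    linarith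
  · rw [h.stageRisk_absorbing hvp _ rfl, hv.zero]

lemma isValueFunction_iterStage (h : IsTransientModel h0 σ w) (π : G.Rule) {v : X → ℝ}
    (hv : G.IsValueFunction w v) (T : ℕ) : G.IsValueFunction w (iterStage h0 σ π v T) := by
  induction T with
  | zero => exact hv
  | succ T ih => exact h.isValueFunction_stageRisk π ih

lemma iterStage_mono (h : IsTransientModel h0 σ w) (π : G.Rule) {v v' : X → ℝ}
    (hv : G.IsValueFunction w v) (hv' : G.IsValueFunction w v') (hle : ∀ x, v x ≤ v' x) (T : ℕ) :
    ∀ x, iterStage h0 σ π v T x ≤ iterStage h0 σ π v' T x := by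
  induction T with
  | zero => exact hle
  | succ T ih =>
    have h1 := h.isValueFunction_iterStage π hv T
    have h2 := h.isValueFunction_iterStage π hv' T
    exact fun x => h.stageRisk_mono (h.memLp h1.measurable h1.bounded)
      (h.memLp h2.measurable h2.bounded) ih _

lemma abs_iterStage_sub_le (h : IsTransientModel h0 σ w) (π : G.Rule) {v v' : X → ℝ}
    (hv : G.IsValueFunction w v) (hv' : G.IsValueFunction w v') {C : ℝ} (hC : 0 ≤ C)
    (hle : ∀ x, |v x - v' x| ≤ C * G.effWeight w x) (T : ℕ) :
    ∀ x, |iterStage h0 σ π v T x - iterStage h0 σ π v' T x| ≤ C * iterWeight h0 σ w π T x := by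
  obtain ⟨K, -, hK⟩ := exists_sum_iterWeight_le h.risk h.ne_top h.measurable_weight
    h.one_le_weight h.memLp_weight h.transient
  induction T with
  | zero => exact hle
  | succ T ih =>
    intro x
    have h1 := h.isValueFunction_iterStage π hv T
    have h2 := h.isValueFunction_iterStage π hv' T
    have h3 := ((hK π).1 T).2
    have := h.abs_stageRisk_sub_le (h.memLp h1.measurable h1.bounded)
      (h.memLp h2.measurable h2.bounded) (h3.const_mul C) ih (π.at x)
    rwa [risk_const_mul h.risk h3 hC] at this

lemma summable_iterWeight (h : IsTransientModel h0 σ w) (π : G.Rule) (x : X) :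
    Summable fun k => iterWeight h0 σ w π k x := by
  obtain ⟨K, -, hK⟩ := exists_sum_iterWeight_le h.risk h.ne_top h.measurable_weight
    h.one_le_weight h.memLp_weight h.transient
  exact summable_of_sum_range_le (fun k => (hK π).2.1 k x) fun T => (hK π).2.2.2 T x

lemma exists_finiteRisk_succ_sub_le (h : IsTransientModel h0 σ w) : ∃ C, 0 ≤ C ∧
    ∀ (π : G.Rule) T x, |finiteRisk h0 σ π (T + 1) x - finiteRisk h0 σ π T x| ≤
      C * iterWeight h0 σ w π T x := by
  obtain ⟨C, hC0, hC⟩ := h.exists_stageRisk_zero_le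
  refine ⟨C, hC0, fun π T x => ?_⟩
  have hz := isValueFunction_zero G w
  -- J_{T+1} and J_T are the T-fold iterates started from the one-step risk of the costs and from 0.
  have := h.abs_iterStage_sub_le π (h.isValueFunction_stageRisk π hz) hz hC0
    (fun x => by rw [sub_zero]; exact hC π x) T x
  rwa [← iterStage_succ', iterStage_zero_eq_finiteRisk, iterStage_zero_eq_finiteRisk] at this

/-- The limit of the finite horizon risks exists. -/
theorem tendsto_finiteRisk (h : IsTransientModel h0 σ w) (π : G.Rule) (x : X) :
    Tendsto (fun T => finiteRisk h0 σ π T x) atTop (𝓝 (totalRisk h0 σ π x)) := by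
  obtain ⟨C, hC0, hC⟩ := h.exists_finiteRisk_succ_sub_le
  have hc : CauchySeq fun T => finiteRisk h0 σ π T x :=
    cauchySeq_of_dist_le_of_summable (fun k => C * iterWeight h0 σ w π k x)
      (fun T => by rw [dist_comm, Real.dist_eq]; exact hC π T x)
      ((h.summable_iterWeight π x).mul_left C)
  exact hc.tendsto_limUnder

lemma exists_finiteRisk_le (h : IsTransientModel h0 σ w) : ∃ C, 0 ≤ C ∧
    ∀ (π : G.Rule) T x, |finiteRisk h0 σ π T x| ≤ C * G.effWeight w x := by
  obtain ⟨C, hC0, hC⟩ := h.exists_finiteRisk_succ_sub_le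
  obtain ⟨K, hK0, hK⟩ := exists_sum_iterWeight_le h.risk h.ne_top h.measurable_weight
    h.one_le_weight h.memLp_weight h.transient
  refine ⟨C * (K + 1), by positivity, fun π T x => ?_⟩
  have h1 : |finiteRisk h0 σ π T x| ≤ C * ∑ k ∈ Finset.range T, iterWeight h0 σ w π k x := by
    induction T with
    | zero => simp [finiteRisk]
    | succ T ih =>
      rw [Finset.sum_range_succ, mul_add]
      have h2 := hC π T x
      have h3 := abs_sub_abs_le_abs_sub (finiteRisk h0 σ π (T + 1) x) (finiteRisk h0 σ π T x)
      linarith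
  rw [mul_assoc]
  exact h1.trans (mul_le_mul_of_nonneg_left ((hK π).2.2.2 T x) hC0)

lemma exists_totalRisk_le (h : IsTransientModel h0 σ w) : ∃ C, 0 ≤ C ∧
    ∀ (π : G.Rule) x, |totalRisk h0 σ π x| ≤ C * G.effWeight w x := by
  obtain ⟨C, hC0, hC⟩ := h.exists_finiteRisk_le
  exact ⟨C, hC0, fun π x => le_of_tendsto (h.tendsto_finiteRisk π x).abs
    (Eventually.of_forall fun T => hC π T x)⟩

lemma measurable_finiteRisk (h : IsTransientModel h0 σ w) (π : G.Rule) (T : ℕ) :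
    Measurable (finiteRisk h0 σ π T) := by
  rw [← iterStage_zero_eq_finiteRisk]
  exact (h.isValueFunction_iterStage π (isValueFunction_zero G w) T).measurable

lemma isValueFunction_totalRisk (h : IsTransientModel h0 σ w) (π : G.Rule) :
    G.IsValueFunction w (totalRisk h0 σ π) := by
  obtain ⟨C, hC0, hC⟩ := h.exists_totalRisk_le
  refine ⟨measurable_of_tendsto_metrizable (fun T => h.measurable_finiteRisk π T)
    (tendsto_pi_nhds.2 fun x => h.tendsto_finiteRisk π x),
    h.wBounded_of_effWeight hC0 (hC π), ?_⟩
  have := hC π G.xA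
  rw [effWeight_xA, mul_zero] at this
  exact abs_nonpos_iff.1 this

/-- The policy evaluation equation. -/
theorem stageRisk_totalRisk (h : IsTransientModel h0 σ w) (π : G.Rule) (x : X) :
    stageRisk h0 σ (totalRisk h0 σ π) (π.at x) = totalRisk h0 σ π x := by
  obtain ⟨C, hC0, hC⟩ := h.exists_finiteRisk_le
  have h1 := h.tendsto_stageRisk (fun T => h.measurable_finiteRisk π T)
    (fun T x => (hC π T x).trans
      (mul_le_mul_of_nonneg_left (effWeight_le h.one_le_weight x) hC0))
    (h.tendsto_finiteRisk π) (π.at x)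
  exact tendsto_nhds_unique h1 ((h.tendsto_finiteRisk π x).comp (tendsto_add_atTop_nat 1))

/-- The influence of the terminal function is a multiple of the T-th term of a convergent series, so
it vanishes in the limit. -/
lemma tendsto_iterStage (h : IsTransientModel h0 σ w) (π : G.Rule) {v : X → ℝ}
    (hv : G.IsValueFunction w v) (x : X) :
    Tendsto (fun T => iterStage h0 σ π v T x) atTop (𝓝 (totalRisk h0 σ π x)) := by
  obtain ⟨C, hC0, hC⟩ := abs_le_effWeight hv h.one_le_weight
  have h1 : ∀ T, |iterStage h0 σ π v T x - finiteRisk h0 σ π T x| ≤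
      C * iterWeight h0 σ w π T x := by
    intro T
    rw [← iterStage_zero_eq_finiteRisk]
    exact h.abs_iterStage_sub_le π hv (isValueFunction_zero G w) hC0
      (fun x => by rw [sub_zero]; exact hC x) T x
  have h2 : Tendsto (fun T => C * iterWeight h0 σ w π T x) atTop (𝓝 0) := by
    simpa using (h.summable_iterWeight π x).tendsto_atTop_zero.const_mul C
  have h3 := squeeze_zero_norm
    (f := fun T => iterStage h0 σ π v T x - finiteRisk h0 σ π T x) h1 h2
  simpa using h3.add (h.tendsto_finiteRisk π x)

/-- Iterating the monotone operator preserves v ≤ D_π^T v, and the right-hand side tends to J_∞ from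
any starting function in the class. -/
lemma le_totalRisk (h : IsTransientModel h0 σ w) (π : G.Rule) {v : X → ℝ}
    (hv : G.IsValueFunction w v) (hle : ∀ x, v x ≤ stageRisk h0 σ v (π.at x)) (x : X) :
    v x ≤ totalRisk h0 σ π x := by
  have h1 : ∀ T, ∀ x, v x ≤ iterStage h0 σ π v T x := by
    intro T
    induction T with
    | zero => exact fun x => le_rfl
    | succ T ih =>
      intro x
      rw [iterStage_succ']
      exact (ih x).trans (h.iterStage_mono π hv (h.isValueFunction_stageRisk π hv) hle T x)
  exact ge_of_tendsto' (h.tendsto_iterStage π hv x) fun T => h1 T x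

lemma totalRisk_le (h : IsTransientModel h0 σ w) (π : G.Rule) {v : X → ℝ}
    (hv : G.IsValueFunction w v) (hle : ∀ x, stageRisk h0 σ v (π.at x) ≤ v x) (x : X) :
    totalRisk h0 σ π x ≤ v x := by
  have h1 : ∀ T, ∀ x, iterStage h0 σ π v T x ≤ v x := by
    intro T
    induction T with
    | zero => exact fun x => le_rfl
    | succ T ih =>
      intro x
      rw [iterStage_succ']
      exact (h.iterStage_mono π (h.isValueFunction_stageRisk π hv) hv hle T x).trans (ih x)
  exact le_of_tendsto' (h.tendsto_iterStage π hv x) fun T => h1 T x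

end IsTransientModel

lemma DPEquations.le_stageRisk {v : X → ℝ} (hv : DPEquations h0 σ v) (z : G.Graph) :
    v z.1.1 ≤ stageRisk h0 σ v z := (hv.1 z.1.1).1 ⟨⟨z.1.2, z.2⟩, rfl⟩

lemma DPEquations.eq_stageRisk {v : X → ℝ} (hv : DPEquations h0 σ v) {π : G.Rule}
    (hπ : IsMinimizer h0 σ v π) (x : X) : v x = stageRisk h0 σ v (π.at x) := by
  refine le_antisymm (hv.le_stageRisk (π.at x)) ((hv.1 x).2 ?_)
  rintro _ ⟨u, rfl⟩
  exact hπ ⟨(x, u.1), u.2⟩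

namespace IsTransientModel

/-- A solution of the dynamic programming equations is the total risk of every policy of
minimizers. -/
lemma totalRisk_eq_of_isMinimizer (h : IsTransientModel h0 σ w) {v : X → ℝ}
    (hv : G.IsValueFunction w v) (hdp : DPEquations h0 σ v) {π : G.Rule}
    (hπ : IsMinimizer h0 σ v π) (x : X) : totalRisk h0 σ π x = v x :=
  le_antisymm (h.totalRisk_le π hv (fun x => (hdp.eq_stageRisk hπ x).ge) x)
    (h.le_totalRisk π hv (fun y => hdp.le_stageRisk (π.at y)) x)

lemma bddBelow_totalRisk (h : IsTransientModel h0 σ w) (x : X) :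
    BddBelow (Set.range fun π : G.Rule => totalRisk h0 σ π x) := by
  obtain ⟨C, hC0, hC⟩ := h.exists_totalRisk_le
  exact ⟨-(C * G.effWeight w x), by rintro _ ⟨π, rfl⟩; exact (abs_le.1 (hC π x)).1⟩

lemma eq_optimalValue (h : IsTransientModel h0 σ w) {v : X → ℝ} (hv : G.IsValueFunction w v)
    (hdp : DPEquations h0 σ v) (hex : ∃ π : G.Rule, IsMinimizer h0 σ v π) (x : X) :
    v x = optimalValue h0 σ x := by
  obtain ⟨π, hπ⟩ := hex
  have : Nonempty G.Rule := ⟨π⟩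
  refine le_antisymm (le_ciInf fun π' => h.le_totalRisk π' hv
    (fun y => hdp.le_stageRisk (π'.at y)) x) ?_
  rw [← h.totalRisk_eq_of_isMinimizer hv hdp hπ x]
  exact ciInf_le (h.bddBelow_totalRisk x) π

/-- Policy iteration yields a solution of the dynamic programming equations. -/
theorem exists_solution (h : IsTransientModel h0 σ w)
    (hmin : ∀ v, G.IsValueFunction w v → ∃ π : G.Rule, IsMinimizer h0 σ v π) :
    ∃ v, G.IsValueFunction w v ∧ DPEquations h0 σ v := by
  -- Policy iteration: each rule is followed by a minimizer for its own total risk.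
  choose next hnext using fun π : G.Rule => hmin _ (h.isValueFunction_totalRisk π)
  obtain ⟨π₀, -⟩ := hmin _ (isValueFunction_zero G w)
  let π : ℕ → G.Rule := fun n => next^[n] π₀
  let v : ℕ → X → ℝ := fun n => totalRisk h0 σ (π n)
  have hv : ∀ n, G.IsValueFunction w (v n) := fun n => h.isValueFunction_totalRisk _
  have hmem : ∀ n, MemLp (v n) p P₀ := fun n => h.memLp (hv n).measurable (hv n).bounded
  have hmin' : ∀ n, IsMinimizer h0 σ (v n) (π (n + 1)) := by
    intro n
    have : π (n + 1) = next (π n) := Function.iterate_succ_apply' next n π₀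
    rw [this]
    exact hnext (π n)
  have himp : ∀ n x, stageRisk h0 σ (v n) ((π (n + 1)).at x) ≤ v n x := fun n x =>
    -- The new rule does at least as well as π n in one step, and π n reproduces v n by policy
    -- evaluation. Comparison then gives v (n + 1) ≤ v n.
    (hmin' n ((π n).at x)).trans (h.stageRisk_totalRisk (π n) x).le
  have hanti : ∀ n x, v (n + 1) x ≤ v n x := fun n x =>
    h.totalRisk_le (π (n + 1)) (hv n) (himp n) x
  have hupper : ∀ n x, v (n + 1) x ≤ stageRisk h0 σ (v n) ((π (n + 1)).at x) := by
    intro n x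
    refine (h.stageRisk_totalRisk (π (n + 1)) x).ge.trans ?_
    exact h.stageRisk_mono (hmem (n + 1)) (hmem n) (hanti n) _
  obtain ⟨C, hC0, hC⟩ := h.exists_totalRisk_le
  have hCv : ∀ n x, |v n x| ≤ C * G.effWeight w x := fun n => hC (π n)
  have hCw : ∀ n x, |v n x| ≤ C * w x := fun n x => (hCv n x).trans
    (mul_le_mul_of_nonneg_left (effWeight_le h.one_le_weight x) hC0)
  let V : X → ℝ := fun x => ⨅ n, v n x
  have hlim : ∀ x, Tendsto (fun n => v n x) atTop (𝓝 (V x)) := fun x =>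
    tendsto_atTop_ciInf (antitone_nat_of_succ_le fun n => hanti n x)
      ⟨-(C * w x), by rintro _ ⟨n, rfl⟩; exact (abs_le.1 (hCw n x)).1⟩
  have hstage : ∀ z : G.Graph, Tendsto (fun n => stageRisk h0 σ (v n) z) atTop
      (𝓝 (stageRisk h0 σ V z)) :=
    h.tendsto_stageRisk (fun n => (hv n).measurable) hCw hlim
  have hV : G.IsValueFunction w V := by
    refine ⟨Measurable.iInf fun n => (hv n).measurable, ⟨C, fun x =>
      le_of_tendsto (hlim x).abs (Eventually.of_forall fun n => hCw n x)⟩, ?_⟩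
    simp only [V, fun n => (hv n).zero, ciInf_const]
  refine ⟨V, hV, fun x => ⟨?_, fun b hb => ?_⟩, hV.zero⟩
  · rintro _ ⟨u, rfl⟩
    -- For fixed u, v (n + 1) is at most the minimal stage risk for v n, hence at most the stage
    -- risk at u; dominated convergence passes to V.
    exact le_of_tendsto_of_tendsto' ((hlim x).comp (tendsto_add_atTop_nat 1))
      (hstage ⟨(x, u.1), u.2⟩) fun n => (hupper n x).trans (hmin' n ⟨(x, u.1), u.2⟩)
  · refine ge_of_tendsto' (hlim x) fun n => ?_
    -- A lower bound b for V is tested at the control of rule n + 1; since V ≤ v n, the stage risk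
    -- there is at most v n x for every n.
    refine le_trans (hb ⟨⟨(π (n + 1)).1 x, (π (n + 1)).2.2 x⟩, rfl⟩) ?_
    refine le_trans ?_ (himp n x)
    exact h.stageRisk_mono (h.memLp hV.measurable hV.bounded) (hmem n)
      (fun y => (antitone_nat_of_succ_le fun n => hanti n y).le_of_tendsto (hlim y) n) _

end IsTransientModel

end DynamicProgramming

end Model

end RiskAverse

end

theorem theoremt {X 𝒰 : Type*}
    [TopologicalSpace X] [TopologicalSpace.MetrizableSpace X] [SecondCountableTopology X]
    [MeasurableSpace X] [BorelSpace X] [StandardBorelSpace X]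
    [TopologicalSpace 𝒰] [TopologicalSpace.MetrizableSpace 𝒰] [SecondCountableTopology 𝒰]
    [MeasurableSpace 𝒰] [BorelSpace 𝒰] [StandardBorelSpace 𝒰]
    (G : RiskAverse.Model X 𝒰)
    (p : ℝ≥0∞) [Fact (1 ≤ p)] (hp : p ≠ ∞)
    (P₀ : Measure X) [IsProbabilityMeasure P₀]
    (σ : Lp ℝ p P₀ → X → RiskAverse.ProbDual p P₀ → ℝ) (hσ : RiskAverse.IsRiskTransition σ)
    (w : X → ℝ) (hw_meas : Measurable w) (hw_one : ∀ x, 1 ≤ w x) (hw_mem : MemLp w p P₀)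
    (h0 : G.G0 p P₀) (h1 : RiskAverse.Model.G1 h0) (h2 : RiskAverse.RiskSetLSC σ)
    (h3 : G.G3 w) (h4 : G.G4)
    (htrans : RiskAverse.Model.UniformlyRiskTransient h0 σ w) :
    -- the limits defining `J_∞` exist, and the infimum defining `J^*` is finite
    (∀ (π : G.Rule) (x : X), Tendsto (fun T => RiskAverse.Model.finiteRisk h0 σ π T x) atTop
      (𝓝 (RiskAverse.Model.totalRisk h0 σ π x))) ∧
    (∀ x, BddBelow (Set.range fun π : G.Rule => RiskAverse.Model.totalRisk h0 σ π x)) ∧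
    -- `J^*` is measurable and `w`-bounded
    Measurable (RiskAverse.Model.optimalValue h0 σ) ∧
    RiskAverse.WBounded w (RiskAverse.Model.optimalValue h0 σ) ∧
    -- the dynamic programming equations characterize `J^*`
    (∀ v : X → ℝ, Measurable v → RiskAverse.WBounded w v →
      (RiskAverse.Model.DPEquations h0 σ v ↔ ∀ x, v x = RiskAverse.Model.optimalValue h0 σ x)) ∧
    -- a measurable minimizer exists, and every such minimizer defines an optimal policy
    (∃ π : G.Rule, RiskAverse.Model.IsMinimizer h0 σ (RiskAverse.Model.optimalValue h0 σ) π) ∧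
    (∀ π : G.Rule, RiskAverse.Model.IsMinimizer h0 σ (RiskAverse.Model.optimalValue h0 σ) π →
      ∀ x, RiskAverse.Model.totalRisk h0 σ π x = RiskAverse.Model.optimalValue h0 σ x) := by
  have hm : RiskAverse.Model.IsTransientModel h0 σ w :=
    ⟨hσ, hp, hw_meas, hw_one, hw_mem, h3, htrans⟩
  have hmin : ∀ v, G.IsValueFunction w v → ∃ π : G.Rule, RiskAverse.Model.IsMinimizer h0 σ v π :=
    fun v hv => RiskAverse.Model.exists_isMinimizer hσ hp h2 h1 h3 h4 hw_meas hw_one hw_mem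
      hv.measurable (hm.memLp hv.measurable hv.bounded)
  obtain ⟨V, hV, hdp⟩ := hm.exists_solution hmin
  have hVJ : V = RiskAverse.Model.optimalValue h0 σ :=
    funext (hm.eq_optimalValue hV hdp (hmin V hV))
  rw [hVJ] at hV hdp
  refine ⟨hm.tendsto_finiteRisk, hm.bddBelow_totalRisk, hV.measurable, hV.bounded,
    fun v hvm hvb => ⟨fun hv => ?_, fun hv => ?_⟩, hmin _ hV,
    fun π hπ => hm.totalRisk_eq_of_isMinimizer hV hdp hπ⟩
  -- Uniqueness needs a minimizer for this v as well, which exists for every function in the class.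
  · have hv' : G.IsValueFunction w v := ⟨hvm, hvb, hv.2⟩
    exact hm.eq_optimalValue hv' hv (hmin v hv')
  · rwa [funext hv]
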